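/- Let $\lambda$ be Lebesgue measure on the unit-length circle $\mathbb T=\mathbb R/\mathbb Z$, let $e_n(t)=e^{2\pi i n t}$, and write $(u,v)_\lambda=\int u\,\overline v\,d\lambda$, $\|u\|_\lambda^2=(u,u)_\lambda$. Let $H^2(\mathbb T)$ be the space of $u\in L^2(\lambda)$ with $\int u\,\overline{e_n}\,d\lambda=0$ for all $n<0$, and let $P_{H^2}:L^2(\lambda)\to H^2(\mathbb T)$ be the orthogonal projection. A function $\varphi$ on $\mathbb T$ is called outer if there are $c\in\mathbb C$ with $|c|=1$ and $f\ge 0$ with $\log f\in L^1(\lambda)$ (so that $f>0$ a.e.) such that for $\lambda$-a.e. $t$ $$\varphi(t)=\lim_{\rho\uparrow 1}c\,\Phi_f(\rho e_1(t)),\qquad \Phi_f(z)=\exp\Big(\frac12\int_{\mathbb T}\frac{e_1(s)+z}{e_1(s)-z}\,\log f(s)\,d\lambda(s)\Big)\quad(|z|<1).$$ Let $\mathrm{Poly}_n$ be the linear span of $e_0,\dots,e_n$. **Theorem.** Let $\varphi,\psi\in H^2(\mathbb T)$ be outer functions satisfying the angle condition: there are $\epsilon>0$ and $n_0$ such that for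 all $n\ge n_0$ and all $S\in\mathrm{Poly}_n$ there is $T\in\mathrm{Poly}_n\setminus\{0\}$ such that $(\varphi S,\psi T)_\lambda$ is real and $$(\varphi S,\psi T)_\lambda\ \ge\ \epsilon\,\|\varphi S\|_\lambda\,\|\psi T\|_\lambda .$$ Let $\mu=\psi\overline\varphi\,\lambda$, $\widehat\mu(n)=\int \overline{e_n}\,d\mu$ and $D_n(\mu)=\det[\widehat\mu(k-j)]_{0\le j,k\le n}$. Let $r\ge 0$ and $f_0,\dots,f_r,g_0,\dots,g_r\in L^2\big((|\varphi|^2+|\psi|^2)\lambda\big)$, and put $F_j=P_{H^2}(f_j\overline\varphi)$ and $G_j=P_{H^2}(g_j\overline\psi)$ (here $f_j\overline\varphi$ and $g_j\overline\psi$ lie in $L^2(\lambda)$). For $n\ge1$ and $-n\le j\le r$ let $p_j=f_j$ and $q_j=g_j$ if $j\ge 0$, and $p_j=q_j=e_j$ if $j<0$. Then all the integrals $\int p_j\overline{q_k}\,d\mu$ converge absolutely, $D_{n-1}(\mu)\ne0$ for all large $n$, and $$\lim_{n\to\infty}D_{n-1}(\mu)^{-1}\det\Big[\int p_j\,\overline{q_k}\,d\mu\Big]_{-n\le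 j,k\le r}=\det\Big[\int F_j\,\overline{G_k}\,d\lambda\Big]_{0\le j,k\le r}.$$ -/

import Mathlib

open MeasureTheory Filter Topology
open scoped ComplexConjugate

namespace SzegoLimit

/-- The unit-length circle `ℝ/ℤ`. -/
abbrev Circ : Type := UnitAddCircle

/-- Normalized Lebesgue measure on the circle. -/
noncomputable abbrev leb : Measure Circ := AddCircle.haarAddCircle

/-- The character `e_n(t) = exp (2 π i n t)`. -/
noncomputable def e (n : ℤ) : Circ → ℂ := fun t => fourier n t

/-- `φ` belongs to the Hardy space `H²(𝕋)`. -/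
def MemH2 (φ : Circ → ℂ) : Prop :=
  MemLp φ 2 leb ∧ ∀ n : ℤ, n < 0 → fourierCoeff φ n = 0

/-- `Φ_f(z) = exp (1/2 ∫ (e_1(t) + z)/(e_1(t) - z) log f(t) dλ(t))`, for `|z| < 1`. -/
noncomputable def outerExt (f : Circ → ℝ) (z : ℂ) : ℂ :=
  Complex.exp ((1 / 2 : ℂ) * ∫ t, ((e 1 t + z) / (e 1 t - z)) * (Real.log (f t) : ℂ) ∂leb)

/-- `φ` is an outer function: up to a unimodular constant it is a.e. the radial limit of `Φ_f`
for some `f ≥ 0` with `log f ∈ L¹(λ)`. Since `Real.log 0 = 0` rather than `-∞`, the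
requirement `f > 0` a.e., which is part of `log f ∈ L¹(λ)`, is written out. -/
def IsOuter (φ : Circ → ℂ) : Prop :=
  ∃ (c : ℂ) (f : Circ → ℝ), ‖c‖ = 1 ∧ (∀ᵐ t ∂leb, 0 < f t) ∧
    Integrable (fun t => Real.log (f t)) leb ∧
    ∀ᵐ t ∂leb, Tendsto (fun r : ℝ => c * outerExt f ((r : ℂ) * e 1 t)) (𝓝[<] 1) (𝓝 (φ t))

/-- `Poly_n`, the linear span of `e_0, …, e_n`. -/
noncomputable def Poly (n : ℕ) : Submodule ℂ (Circ → ℂ) :=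
  Submodule.span ℂ (Set.range fun k : Fin (n + 1) => e (k : ℤ))

/-- The pairing `(u, v)_λ = ∫ u conj(v) dλ`. -/
noncomputable def ip (u v : Circ → ℂ) : ℂ := ∫ t, u t * conj (v t) ∂leb

/-- The norm of `L²(λ)`. -/
noncomputable def l2norm (u : Circ → ℂ) : ℝ := (eLpNorm u 2 leb).toReal

open scoped ComplexOrder in
/-- The angle condition between `φ Poly_n` and `ψ Poly_n`, uniformly for large `n`. In the order
of `ℂ` used here, `a ≤ z` for real `a` says that `z` is real and at least `a`. -/
def AngleCondition (φ ψ : Circ → ℂ) : Prop :=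
  ∃ ε : ℝ, 0 < ε ∧ ∃ n₀ : ℕ, ∀ n : ℕ, n₀ ≤ n → ∀ S ∈ Poly n, ∃ T ∈ Poly n, T ≠ 0 ∧
    ((ε * l2norm (φ * S) * l2norm (ψ * T) : ℝ) : ℂ) ≤ ip (φ * S) (ψ * T)

/-- The measure `(|φ|² + |ψ|²) λ`. -/
noncomputable def sumWeight (φ ψ : Circ → ℂ) : Measure Circ :=
  leb.withDensity fun t => ((‖φ t‖₊ ^ 2 + ‖ψ t‖₊ ^ 2 : NNReal) : ENNReal)

/-- The density `ψ conj(φ)` of the complex measure `μ = ψ conj(φ) λ`. -/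
noncomputable def density (φ ψ : Circ → ℂ) : Circ → ℂ := fun t => ψ t * conj (φ t)

/-- The integral `∫ u dμ` against the complex measure `μ = h λ`. -/
noncomputable def densityIntegral (h u : Circ → ℂ) : ℂ := ∫ t, u t * h t ∂leb

/-- The Fourier coefficients `μ̂(n) = ∫ e^{-2πint} dμ(t)` of the complex measure `μ = h λ`. -/
noncomputable def measCoeff (h : Circ → ℂ) (n : ℤ) : ℂ := densityIntegral h (e (-n))

/-- The Toeplitz determinant `D_n(μ) = det [μ̂(k - j)]_{0 ≤ j, k ≤ n}` of `μ = h λ`. -/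
noncomputable def toeplitzDet (h : Circ → ℂ) (n : ℕ) : ℂ :=
  (Matrix.of fun j k : Fin (n + 1) => measCoeff h ((k : ℤ) - (j : ℤ))).det

/-- The family consisting of `f_0, …, f_r` and `e_{-1}, …, e_{-n}`. -/
noncomputable def bordered {r : ℕ} (f : Fin (r + 1) → Circ → ℂ) (n : ℕ) :
    Fin (r + 1) ⊕ Fin n → Circ → ℂ :=
  Sum.elim f fun i => e (-((i : ℤ) + 1))

/-- The determinant `det [∫ p_j conj(q_k) dμ]` for `μ = h λ`, where `p` is the family
`f_0, …, f_r, e_{-1}, …, e_{-n}` and `q` is the family `g_0, …, g_r, e_{-1}, …, e_{-n}`. -/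
noncomputable def borderedDet {r : ℕ} (h : Circ → ℂ) (f g : Fin (r + 1) → Circ → ℂ) (n : ℕ) : ℂ :=
  (Matrix.of fun j k : Fin (r + 1) ⊕ Fin n =>
    densityIntegral h fun t => bordered f n j t * conj (bordered g n k t)).det

/-- The Hardy space `H²(𝕋)` as a subspace of `L²(λ)`. -/
noncomputable def hardy : Submodule ℂ (Lp ℂ 2 leb) where
  carrier := {u | ∀ n : ℤ, n < 0 → fourierCoeff (u : Circ → ℂ) n = 0}
  zero_mem' := fun n _ => by
    rw [← fourierBasis_repr]; simp
  add_mem' := fun {u v} hu hv n hn => by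
    have h1 := hu n hn
    have h2 := hv n hn
    rw [← fourierBasis_repr] at h1 h2 ⊢
    simp [h1, h2]
  smul_mem' := fun c u hu n hn => by
    have h1 := hu n hn
    rw [← fourierBasis_repr] at h1 ⊢
    simp [h1]

theorem isClosed_hardy : IsClosed (hardy : Set (Lp ℂ 2 leb)) := by
  have h : (hardy : Set (Lp ℂ 2 leb)) =
      ⋂ n : ℤ, ⋂ _ : n < 0, {u | inner ℂ (fourierBasis (T := 1) n) u = (0 : ℂ)} := by
    ext u
    simp only [Set.mem_iInter, Set.mem_ofPred_eq, SetLike.mem_coe]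
    refine forall_congr' fun n => forall_congr' fun _ => ?_
    rw [← fourierBasis_repr, HilbertBasis.repr_apply_apply]
  rw [h]
  exact isClosed_iInter fun n => isClosed_iInter fun _ =>
    isClosed_eq (continuous_const.inner continuous_id) continuous_const

instance : CompleteSpace hardy := isClosed_hardy.completeSpace_coe

/-- The orthogonal projection `P_{H²}` from `L²(λ)` to `H²(𝕋)`, applied to a function `u` that is
square integrable. -/
noncomputable def hardyProj (u : Circ → ℂ) (hu : MemLp u 2 leb) : Lp ℂ 2 leb :=
  hardy.starProjection (hu.toLp u)

/-- If `f ∈ L²(|φ|² + |ψ|²)`, then `f conj(φ) ∈ L²(λ)`. -/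
theorem memLp_mul_conj_left {φ ψ f : Circ → ℂ} (hφ : MemLp φ 2 leb) (hψ : MemLp ψ 2 leb)
    (hf : MemLp f 2 (sumWeight φ ψ)) : MemLp (fun t => f t * conj (φ t)) 2 leb := by
  classical
  set w : Circ → NNReal := fun t => ‖φ t‖₊ ^ 2 + ‖ψ t‖₊ ^ 2 with hw
  have hwm : AEMeasurable w leb :=
    (hφ.1.nnnorm.aemeasurable.pow_const 2).add (hψ.1.nnnorm.aemeasurable.pow_const 2)
  have hS : sumWeight φ ψ = leb.withDensity fun t => ((hwm.mk w t : NNReal) : ENNReal) := by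
    refine withDensity_congr_ae ?_
    filter_upwards [hwm.ae_eq_mk] with t ht
    rw [← ht]
  have hm : AEStronglyMeasurable (fun t => f t * conj (φ t)) leb := by
    have h1 := hf.1
    rw [hS, aestronglyMeasurable_withDensity_iff hwm.measurable_mk] at h1
    have h2 : AEStronglyMeasurable (fun t => (((hwm.mk w t : NNReal) : ℝ) • f t) *
        (conj (φ t) * ((((hwm.mk w t : NNReal) : ℝ)⁻¹ : ℝ) : ℂ))) leb := by
      refine h1.mul ((Complex.continuous_conj.comp_aestronglyMeasurable hφ.1).mul ?_)
      exact (Complex.measurable_ofReal.comp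
        (measurable_coe_nnreal_real.comp hwm.measurable_mk).inv).aestronglyMeasurable
    refine h2.congr ?_
    filter_upwards [hwm.ae_eq_mk] with t ht
    rw [← ht]
    by_cases h0 : w t = 0
    · have h3 : φ t = 0 := by
        have h4 : ‖φ t‖₊ ^ 2 + ‖ψ t‖₊ ^ 2 = 0 := h0
        simpa using (add_eq_zero.1 h4).1
      simp [h3]
    · have h3 : ((w t : ℝ) : ℂ) ≠ 0 := by
        exact_mod_cast h0
      rw [Complex.real_smul, Complex.ofReal_inv]
      field_simp
  refine ⟨hm, ?_⟩
  have hlt := hf.2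
  rw [eLpNorm_lt_top_iff_lintegral_rpow_enorm_lt_top (by norm_num) (by norm_num)] at hlt ⊢
  refine lt_of_le_of_lt ?_ hlt
  rw [hS, lintegral_withDensity_eq_lintegral_mul_non_measurable₀ _
    hwm.measurable_mk.coe_nnreal_ennreal.aemeasurable (by simp)]
  refine lintegral_mono_ae ?_
  filter_upwards [hwm.ae_eq_mk] with t ht
  rw [Pi.mul_apply, ← ht, enorm_mul, RCLike.enorm_conj]
  simp only [ENNReal.toReal_ofNat, ENNReal.rpow_ofNat, mul_pow]
  rw [mul_comm]
  gcongr
  simp only [hw, ENNReal.coe_add, ENNReal.coe_pow]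
  exact le_self_add

/-- If `f ∈ L²(|φ|² + |ψ|²)`, then `f conj(ψ) ∈ L²(λ)`. -/
theorem memLp_mul_conj_right {φ ψ f : Circ → ℂ} (hφ : MemLp φ 2 leb) (hψ : MemLp ψ 2 leb)
    (hf : MemLp f 2 (sumWeight φ ψ)) : MemLp (fun t => f t * conj (ψ t)) 2 leb := by
  refine memLp_mul_conj_left hψ hφ ?_
  rwa [sumWeight, funext fun t => congrArg ((↑) : NNReal → ENNReal)
    (add_comm (‖ψ t‖₊ ^ 2) (‖φ t‖₊ ^ 2))]

end SzegoLimit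

/-!
Multiplication by `conj φ` and `conj ψ` turns the integrals `∫ p_j conj(q_k) dμ` into inner products
in `L²(λ)`: with `x_i = e_{-(i+1)} conj φ`, `y_i = e_{-(i+1)} conj ψ`, `a_j = f_j conj φ` and `b_k =
g_k conj ψ`, the Toeplitz determinant of size `n` is that of the cross Gram matrix of `x_0, …,
x_{n-1}` and `y_0, …, y_{n-1}`, and the bordered determinant is that of the same families with the
`a_j` and the `b_k` adjoined. Their quotient is therefore the determinant of a Schur complement,
whose entries are `⟪b_k, a_j - v_n⟫`, where `v_n` is the oblique projection of `a_j` onto `X_n =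
span (x_0, …, x_{n-1})` along the orthogonal complement of `Y_n = span (y_0, …, y_{n-1})`. The angle
condition makes the Gram matrix invertible and bounds these projections by `1 / ε`. They annihilate
`H²`, because `y_i ⟂ H²`, and they fix `X_m` for `m ≤ n`. Hence, as soon as `⋃ X_m` is dense in the
orthogonal complement of `H²`, `a_j - v_n` tends to `P_{H²} a_j` (`tendsto_obliqueProjection`,
`tendsto_det_crossGram_ratio`).

The density is the cyclicity of the outer function `φ` in `H²`. Write `G_u = exp (H u / 2)`, with `H
u` the Herglotz integral of `u`, so that `|G_u|²` is the exponential of the Poisson integral of `u`.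
Poisson integrals converge in `L¹` (`tendsto_poissonError`), hence almost everywhere along some
sequence of radii, which gives `|φ|² = f` almost everywhere. Let `m_N = min (-log f) N`. Dilates of
`G_{m_N}` are uniform limits of polynomials, and in the limit `‖G_{m_N} φ‖² ≤ ∫ exp (m_N) f ≤ 1`,
while the mean of `G_{m_N} φ` is `c exp (½ ∫ min 0 (log f + N))`, which tends to `c` as `N → ∞`. So
`G_{m_N} φ` comes arbitrarily close to the constant `c` (`IsOuter.exists_dilate_mul_sub_const`). The
formula for the mean rests on `∫ φ = c Φ_f(0)` (`integral_eq_of_radial_limit`), which follows by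
dominated convergence after multiplication by the bounded function `G_{m_0}`. No theorem on the
existence of radial limits is needed.
-/

namespace SzegoLimit

/-! ### Cross Gram determinants of finite sections in a Hilbert space -/

section Hilbert

variable {V : Type*} [NormedAddCommGroup V] [InnerProductSpace ℂ V]

/-- The finite sections `X_n = span (x_0, …, x_{n-1})` and `Y_n = span (y_0, …, y_{n-1})` make an
angle bounded away from `π / 2`: every `v ∈ X_n` has a nonzero partner in `Y_n`. -/
def SectionAngle (x y : ℕ → V) (ε : ℝ) (n : ℕ) : Prop :=
  ∀ s : Fin n → ℂ, ∃ t : Fin n → ℂ, t ≠ 0 ∧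
    ε * ‖∑ i, s i • x i‖ * ‖∑ i, t i • y i‖ ≤ ‖inner ℂ (∑ i, t i • y i) (∑ i, s i • x i)‖

/-- The cross Gram matrix of two finite families. -/
noncomputable def crossGram {ι : Type*} (a b : ι → V) : Matrix ι ι ℂ :=
  Matrix.of fun j k => inner ℂ (b k) (a j)

/-- Under the angle condition, `v ∈ X_n` is controlled by any vector `b` that has the same inner
products with `Y_n`: the oblique projection onto `X_n` along `Y_nᗮ` has norm at most `1 / ε`. -/
theorem SectionAngle.norm_le {x y : ℕ → V} {ε : ℝ} {n : ℕ} (h : SectionAngle x y ε n)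
    (hy : LinearIndependent ℂ y) (hε : 0 < ε) (s : Fin n → ℂ) (b : V)
    (hb : ∀ l : Fin n, inner ℂ (y l) (∑ i, s i • x i) = inner ℂ (y l) b) :
    ‖∑ i, s i • x i‖ ≤ ‖b‖ / ε := by
  obtain ⟨t, ht, h1⟩ := h s
  have h2 : inner ℂ (∑ i, t i • y i) (∑ i, s i • x i) = inner ℂ (∑ i, t i • y i) b := by
    rw [sum_inner, sum_inner]
    refine Finset.sum_congr rfl fun l _ => ?_
    rw [inner_smul_left, inner_smul_left, hb]
  have h3 : 0 < ‖∑ i, t i • y i‖ := by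
    rw [norm_pos_iff]
    intro h0
    exact ht (funext fun i => Fintype.linearIndependent_iff.1
      (hy.comp (fun i : Fin n => (i : ℕ)) Fin.val_injective) t h0 i)
  rw [h2] at h1
  have h4 := h1.trans (norm_inner_le_norm (𝕜 := ℂ) _ _)
  rw [le_div_iff₀ hε]
  nlinarith

theorem SectionAngle.det_ne_zero {x y : ℕ → V} {ε : ℝ} {n : ℕ} (h : SectionAngle x y ε n)
    (hx : LinearIndependent ℂ x) (hy : LinearIndependent ℂ y) (hε : 0 < ε) :
    (crossGram (fun i : Fin n => x i) fun i : Fin n => y i).det ≠ 0 := by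
  intro h0
  obtain ⟨s, hs, h1⟩ := Matrix.exists_vecMul_eq_zero_iff.2 h0
  refine hs (funext fun i => Fintype.linearIndependent_iff.1
      (hx.comp (fun i : Fin n => (i : ℕ)) Fin.val_injective) s ?_ i)
  have := h.norm_le hy hε s 0 fun l => by
    have h2 := congrFun h1 l
    simp only [Matrix.vecMul, dotProduct, crossGram, Matrix.of_apply, Pi.zero_apply] at h2
    simp only [inner_sum, inner_smul_right, inner_zero_right]
    exact h2
  simpa using this

/-- The oblique projections `v_n` of `a` onto `X_n` along `Y_nᗮ` converge to the orthogonal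
projection of `a` onto `Kᗮ`: they annihilate `K`, they are uniformly bounded, and they fix `X_m`
for `m ≤ n`, where `⋃ X_m` is dense in `Kᗮ`. -/
theorem tendsto_obliqueProjection {x y : ℕ → V} {ε : ℝ} (hε : 0 < ε)
    (hangle : ∀ᶠ n in atTop, SectionAngle x y ε n) (hy : LinearIndependent ℂ y)
    (K : Submodule ℂ V) [K.HasOrthogonalProjection] (hyK : ∀ i, y i ∈ Kᗮ)
    (hdense : Kᗮ ≤ (Submodule.span ℂ (Set.range x)).topologicalClosure)
    (a : V) (s : ∀ n, Fin n → ℂ)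
    (hs : ∀ᶠ n in atTop, ∀ l : Fin n, inner ℂ (y l) (∑ i, s n i • x i) = inner ℂ (y l) a) :
    Tendsto (fun n => ∑ i, s n i • x i) atTop (𝓝 (a - K.starProjection a)) := by
  set b := a - K.starProjection a with hb
  have hbK : b ∈ Kᗮ := K.sub_starProjection_mem_orthogonal a
  rw [Metric.tendsto_atTop']
  intro δ hδ
  obtain ⟨η, hη, hηδ⟩ : ∃ η > 0, η / ε + η < δ := by
    refine ⟨δ / (2 * (1 / ε + 1)), by positivity, ?_⟩
    have : δ / (2 * (1 / ε + 1)) / ε + δ / (2 * (1 / ε + 1)) = δ / 2 := by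
      field_simp
    linarith
  obtain ⟨w, hw, hwb⟩ := Metric.mem_closure_iff.1 (hdense hbK) η hη
  obtain ⟨c, rfl⟩ := (Finsupp.mem_span_range_iff_exists_finsupp).1 hw
  obtain ⟨N, hN⟩ := (hangle.and hs).exists_forall_of_atTop
  obtain ⟨m, hm⟩ : ∃ m, c.support ⊆ Finset.range m :=
    ⟨c.support.sup id + 1, fun i hi => Finset.mem_range.2
      (Nat.lt_succ_of_le (Finset.le_sup (f := id) hi))⟩
  refine ⟨max N m, fun n hn => ?_⟩
  have hNn : N ≤ n := (le_max_left _ _).trans hn.le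
  obtain ⟨h1, h2⟩ := hN n hNn
  have hcn : (c.sum fun i a => a • x i) = ∑ i : Fin n, c i • x i := by
    rw [← Finset.sum_range fun i => c i • x i]
    exact Finsupp.sum_of_support_subset _
      (hm.trans (Finset.range_subset_range.2 ((le_max_right _ _).trans hn.le))) _ (by simp)
  rw [hcn] at hwb
  have h3 := h1.norm_le hy hε (fun i => s n i - c i) (b - ∑ i : Fin n, c i • x i) fun l => by
    have h4 : inner ℂ (y l) (K.starProjection a) = 0 :=
      (Submodule.mem_orthogonal' _ _).1 (hyK l) _ (K.starProjection_apply_mem a)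
    simp only [sub_smul, Finset.sum_sub_distrib]
    rw [inner_sub_right, inner_sub_right, h2, hb, inner_sub_right, h4, sub_zero]
  simp only [sub_smul, Finset.sum_sub_distrib] at h3
  rw [dist_eq_norm] at hwb ⊢
  calc ‖∑ i, s n i • x i - b‖
      = ‖(∑ i, s n i • x i - ∑ i : Fin n, c i • x i) - (b - ∑ i : Fin n, c i • x i)‖ := by
        congr 1; abel
    _ ≤ _ := norm_sub_le _ _
    _ ≤ η / ε + η := by gcongr; exact h3.trans (by gcongr)
    _ < δ := hηδ

/-- The ratio of the bordered cross Gram determinant to the cross Gram determinant of the sections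
is the determinant of the Schur complement, whose entries `⟪b_k, a_j - v_n⟫`, with `v_n` the oblique
projection of `a_j`, converge. -/
theorem tendsto_det_crossGram_ratio {x y : ℕ → V} {ε : ℝ} (hε : 0 < ε)
    (hangle : ∀ᶠ n in atTop, SectionAngle x y ε n)
    (hx : LinearIndependent ℂ x) (hy : LinearIndependent ℂ y)
    (K : Submodule ℂ V) [K.HasOrthogonalProjection] (hyK : ∀ i, y i ∈ Kᗮ)
    (hdense : Kᗮ ≤ (Submodule.span ℂ (Set.range x)).topologicalClosure)
    {m : ℕ} (a b : Fin m → V) :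
    Tendsto (fun n => (crossGram (fun i : Fin n => x i) fun i : Fin n => y i).det⁻¹ *
        (crossGram (Sum.elim a fun i : Fin n => x i) (Sum.elim b fun i : Fin n => y i)).det)
      atTop (𝓝 (crossGram (fun j => K.starProjection (a j)) fun j => K.starProjection (b j)).det)
      := by
  set T : ∀ n, Matrix (Fin n) (Fin n) ℂ :=
    fun n => crossGram (fun i : Fin n => x i) fun i : Fin n => y i
  have hT : ∀ᶠ n in atTop, (T n).det ≠ 0 := hangle.mono fun n h => h.det_ne_zero hx hy hε
  let s : Fin m → ∀ n, Fin n → ℂ := fun j n =>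
    Matrix.vecMul (fun l : Fin n => inner ℂ (y l) (a j)) (T n)⁻¹
  have hs : ∀ j, ∀ᶠ n in atTop, ∀ l : Fin n,
      inner ℂ (y l) (∑ i, s j n i • x i) = inner ℂ (y l) (a j) := by
    intro j
    filter_upwards [hT] with n hn l
    have h1 : Matrix.vecMul (s j n) (T n) = fun l : Fin n => inner ℂ (y l) (a j) := by
      simp only [s]
      rw [Matrix.vecMul_vecMul, Matrix.nonsing_inv_mul _ (isUnit_iff_ne_zero.2 hn),
        Matrix.vecMul_one]
    rw [← congrFun h1 l]
    simp [Matrix.vecMul, dotProduct, T, crossGram]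
  have hlim : Tendsto (fun n => Matrix.of fun j k : Fin m =>
      (inner ℂ (b k) (a j - ∑ i, s j n i • x i) : ℂ)) atTop
      (𝓝 (crossGram (fun j => K.starProjection (a j)) fun j => K.starProjection (b j))) := by
    refine tendsto_pi_nhds.2 fun j => tendsto_pi_nhds.2 fun k => ?_
    have h1 := tendsto_obliqueProjection hε hangle hy K hyK hdense (a j) (s j) (hs j)
    have h2 := (tendsto_const_nhds (x := b k)).inner (𝕜 := ℂ)
      ((tendsto_const_nhds (x := a j)).sub h1)
    rw [sub_sub_cancel] at h2
    have h3 : inner ℂ (b k) (K.starProjection (a j)) =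
        inner ℂ (K.starProjection (b k)) (K.starProjection (a j)) := by
      rw [Submodule.inner_starProjection_left_eq_right,
        K.starProjection_eq_self_iff.2 (K.starProjection_apply_mem _)]
    rw [h3] at h2
    exact h2
  refine (((Continuous.matrix_det continuous_id).tendsto _).comp hlim).congr' ?_
  filter_upwards [hT] with n hn
  have hblock : crossGram (Sum.elim a fun i : Fin n => x i) (Sum.elim b fun i : Fin n => y i) =
      Matrix.fromBlocks (crossGram a b) (Matrix.of fun j (l : Fin n) => inner ℂ (y l) (a j))
        (Matrix.of fun (i : Fin n) k => inner ℂ (b k) (x i)) (T n) := by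
    ext (i | i) (j | j) <;> rfl
  let _ : Invertible (T n) := Matrix.invertibleOfIsUnitDet _ (isUnit_iff_ne_zero.2 hn)
  rw [hblock, Matrix.det_fromBlocks₂₂, ← mul_assoc, inv_mul_cancel₀ hn, one_mul,
    Function.comp_apply, Matrix.invOf_eq_nonsing_inv]
  congr 1
  ext j k
  simp only [id, Matrix.of_apply, inner_sub_right, Matrix.sub_apply, inner_sum, inner_smul_right,
    crossGram, Matrix.mul_apply (M := _ * _)]
  rfl

end Hilbert

/-! ### Herglotz and Poisson integrals on the circle -/

theorem norm_e (n : ℤ) (t : Circ) : ‖e n t‖ = 1 := by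
  simp only [e, fourier_apply]
  exact Circle.norm_coe _

theorem e_ne_zero (n : ℤ) (t : Circ) : e n t ≠ 0 := by
  rw [← norm_ne_zero_iff, norm_e]; exact one_ne_zero

theorem continuous_e (n : ℤ) : Continuous (e n) := (fourier n).continuous

theorem e_zero (t : Circ) : e 0 t = 1 := fourier_zero

theorem e_add (m n : ℤ) (t : Circ) : e (m + n) t = e m t * e n t := fourier_add

theorem e_neg (n : ℤ) (t : Circ) : e (-n) t = conj (e n t) := fourier_neg

theorem e_neg_eq_inv (n : ℤ) (t : Circ) : e (-n) t = (e n t)⁻¹ := by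
  rw [e_neg, Complex.inv_def, Complex.normSq_eq_norm_sq, norm_e]; simp

theorem e_one_pow (k : ℕ) (t : Circ) : e 1 t ^ k = e k t := by
  induction k with
  | zero => simp [e_zero]
  | succ k ih => rw [pow_succ, ih, Nat.cast_succ, e_add]

/-- The kernel `(e_1(s) + z) / (e_1(s) - z)`, whose real part is the Poisson kernel. -/
noncomputable def herglotzKernel (z : ℂ) (s : Circ) : ℂ := (e 1 s + z) / (e 1 s - z)

/-- The Herglotz integral of `u`, an analytic function of `z` in the unit disc. -/
noncomputable def herglotz (u : Circ → ℂ) (z : ℂ) : ℂ := ∫ s, herglotzKernel z s * u s ∂leb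

/-- The Poisson integral of `u`. -/
noncomputable def poissonIntegral (u : Circ → ℂ) (z : ℂ) : ℂ :=
  ∫ s, ((herglotzKernel z s).re : ℂ) * u s ∂leb

theorem e_one_sub_ne_zero {z : ℂ} (hz : ‖z‖ < 1) (s : Circ) : e 1 s - z ≠ 0 := by
  intro h
  rw [← sub_eq_zero.1 h, norm_e] at hz
  exact lt_irrefl _ hz

theorem continuous_herglotzKernel {z : ℂ} (hz : ‖z‖ < 1) : Continuous (herglotzKernel z) :=
  ((continuous_e 1).add continuous_const).div ((continuous_e 1).sub continuous_const)
    (e_one_sub_ne_zero hz)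

theorem norm_herglotzKernel_le {z : ℂ} (hz : ‖z‖ < 1) (s : Circ) :
    ‖herglotzKernel z s‖ ≤ 2 / (1 - ‖z‖) := by
  rw [herglotzKernel, norm_div]
  have h1 : ‖e 1 s + z‖ ≤ 2 := (norm_add_le _ _).trans (by rw [norm_e]; linarith)
  have h2 : 1 - ‖z‖ ≤ ‖e 1 s - z‖ := by
    have := norm_sub_norm_le (e 1 s) z
    rwa [norm_e] at this
  have h3 : 0 < 1 - ‖z‖ := by linarith
  gcongr

theorem integrable_herglotzKernel_mul {z : ℂ} (hz : ‖z‖ < 1) {u : Circ → ℂ}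
    (hu : Integrable u leb) : Integrable (fun s => herglotzKernel z s * u s) leb :=
  hu.bdd_mul (continuous_herglotzKernel hz).aestronglyMeasurable
    (ae_of_all _ (norm_herglotzKernel_le hz))

theorem re_herglotzKernel (z : ℂ) (s : Circ) :
    (herglotzKernel z s).re = (1 - ‖z‖ ^ 2) / ‖e 1 s - z‖ ^ 2 := by
  have h := congrFun (poissonKernel_eq_re_herglotzRieszKernel (c := 0) (w := z)) (e 1 s)
  simp only [poissonKernel, sub_zero, Function.comp_apply, norm_e, one_pow,
    herglotzRieszKernel] at h
  exact h.symm

theorem re_herglotzKernel_nonneg {z : ℂ} (hz : ‖z‖ < 1) (s : Circ) :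
    0 ≤ (herglotzKernel z s).re := by
  rw [re_herglotzKernel]
  have : ‖z‖ ^ 2 ≤ 1 := pow_le_one₀ (norm_nonneg _) hz.le
  exact div_nonneg (by linarith) (by positivity)

theorem hasSum_herglotzKernel {z : ℂ} (hz : ‖z‖ < 1) (s : Circ) :
    HasSum (fun k : ℕ => (if k = 0 then 1 else 2) * z ^ k * e (-(k : ℤ)) s)
      (herglotzKernel z s) := by
  have h1 : ‖z * (e 1 s)⁻¹‖ < 1 := by simpa [norm_e] using hz
  have h2 := ((hasSum_geometric_of_norm_lt_one h1).mul_left 2).sub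
    (hasSum_ite_eq (0 : ℕ) (1 : ℂ))
  have h3 : 2 * (1 - z * (e 1 s)⁻¹)⁻¹ - 1 = herglotzKernel z s := by
    have h4 := e_one_sub_ne_zero hz s
    have h5 := e_ne_zero 1 s
    have h6 : 1 - z * (e 1 s)⁻¹ = (e 1 s - z) / e 1 s := by field_simp
    rw [h6, herglotzKernel, inv_div]
    field_simp
    ring
  rw [h3] at h2
  refine Eq.mpr (congrArg (fun f => HasSum f _) (funext fun k => ?_)) h2
  rw [e_neg_eq_inv, ← e_one_pow, mul_assoc, ← inv_pow, ← mul_pow]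
  by_cases hk : k = 0
  · subst hk; norm_num
  · simp [hk]

theorem hasSum_herglotz {z : ℂ} (hz : ‖z‖ < 1) {u : Circ → ℂ} (hu : Integrable u leb) :
    HasSum (fun k : ℕ => (if k = 0 then 1 else 2) * fourierCoeff u k * z ^ k) (herglotz u z) := by
  have hint : ∀ k : ℕ, Integrable
      (fun s => (if k = 0 then 1 else 2) * z ^ k * e (-(k : ℤ)) s * u s) leb := fun k =>
    hu.bdd_mul (c := ‖(if k = 0 then 1 else 2) * z ^ k‖)
      (continuous_const.mul (continuous_e _)).aestronglyMeasurable
      (ae_of_all _ fun s => by rw [norm_mul, norm_e, mul_one])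
  have h := hasSum_integral_of_summable_integral_norm hint ?_
  · have h3 : herglotz u z = ∫ s, ∑' k : ℕ,
        (if k = 0 then 1 else 2) * z ^ k * e (-(k : ℤ)) s * u s ∂leb :=
      integral_congr_ae (ae_of_all _ fun s =>
        ((hasSum_herglotzKernel hz s).mul_right (u s)).tsum_eq.symm)
    rw [h3]
    refine Eq.mpr (congrArg (fun f => HasSum f _) (funext fun k => ?_)) h
    rw [mul_right_comm, fourierCoeff, ← integral_const_mul]
    refine integral_congr_ae (ae_of_all _ fun s => ?_)
    simp only [smul_eq_mul, e]
    ring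
  · refine Summable.of_nonneg_of_le (fun k => integral_nonneg fun s => norm_nonneg _) (fun k => ?_)
      ((summable_geometric_of_lt_one (norm_nonneg z) hz).mul_right (2 * ∫ s, ‖u s‖ ∂leb))
    rw [← mul_assoc, ← integral_const_mul]
    refine integral_mono (hint k).norm (hu.norm.const_mul _) fun s => ?_
    simp only [norm_mul, norm_e, norm_pow, mul_one]
    have : ‖(if k = 0 then 1 else 2 : ℂ)‖ ≤ 2 := by split_ifs <;> simp
    rw [mul_comm (‖z‖ ^ k)]
    gcongr

theorem herglotz_zero (u : Circ → ℂ) : herglotz u 0 = ∫ s, u s ∂leb := by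
  simp only [herglotz, herglotzKernel, add_zero, sub_zero]
  refine integral_congr_ae (ae_of_all _ fun s => ?_)
  simp [e_ne_zero]

theorem norm_fourierCoeff_le {u : Circ → ℂ} (n : ℤ) :
    ‖fourierCoeff u n‖ ≤ ∫ s, ‖u s‖ ∂leb := by
  rw [fourierCoeff]
  refine (norm_integral_le_integral_norm _).trans (le_of_eq ?_)
  refine integral_congr_ae (ae_of_all _ fun s => ?_)
  simp only [norm_smul]
  rw [show ‖fourier (-n) s‖ = 1 from norm_e (-n) s, one_mul]

theorem differentiableOn_herglotz {u : Circ → ℂ} (hu : Integrable u leb) :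
    DifferentiableOn ℂ (herglotz u) (Metric.ball 0 1) := by
  intro w hw
  obtain ⟨r, hwr, hr⟩ := exists_between (mem_ball_zero_iff.1 hw)
  have hr0 : 0 ≤ r := (norm_nonneg w).trans hwr.le
  have h1 : DifferentiableOn ℂ
      (fun z => ∑' k : ℕ, (if k = 0 then 1 else 2) * fourierCoeff u k * z ^ k)
      (Metric.ball 0 r) := by
    refine Complex.differentiableOn_tsum_of_summable_norm
      ((summable_geometric_of_lt_one hr0 hr).mul_left (2 * ∫ s, ‖u s‖ ∂leb))
      (fun k => by fun_prop) Metric.isOpen_ball fun k z hz => ?_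
    rw [norm_mul, norm_mul, norm_pow]
    have h2 : ‖(if k = 0 then 1 else 2 : ℂ)‖ ≤ 2 := by split_ifs <;> simp
    have h3 := (mem_ball_zero_iff.1 hz).le
    have h4 := norm_fourierCoeff_le (u := u) k
    gcongr
  have h5 : Set.EqOn (herglotz u)
      (fun z => ∑' k : ℕ, (if k = 0 then 1 else 2) * fourierCoeff u k * z ^ k)
      (Metric.ball 0 r) := fun z hz =>
    (hasSum_herglotz ((mem_ball_zero_iff.1 hz).trans hr) hu).tsum_eq.symm
  exact ((h1.congr h5).differentiableAt
    (Metric.isOpen_ball.mem_nhds (mem_ball_zero_iff.2 hwr))).differentiableWithinAt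

theorem herglotz_add {z : ℂ} (hz : ‖z‖ < 1) {u v : Circ → ℂ} (hu : Integrable u leb)
    (hv : Integrable v leb) : herglotz (fun s => u s + v s) z = herglotz u z + herglotz v z := by
  rw [herglotz, herglotz, herglotz, ← integral_add (integrable_herglotzKernel_mul hz hu)
    (integrable_herglotzKernel_mul hz hv)]
  simp only [mul_add]

theorem integrable_e (n : ℤ) : Integrable (e n) leb :=
  (continuous_e n).integrable_of_hasCompactSupport (HasCompactSupport.of_compactSpace _)

theorem herglotz_e {z : ℂ} (hz : ‖z‖ < 1) (n : ℤ) :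
    herglotz (e n) z = if n < 0 then 0 else if n = 0 then 1 else 2 * z ^ n.toNat := by
  have h := hasSum_herglotz hz (integrable_e n)
  have h0 : ∀ k : ℕ, fourierCoeff (e n) k = if (k : ℤ) = n then 1 else 0 := fun k => by
    have := congrFun (fourierCoeff_fourier (T := 1) n) k
    rw [Pi.single_apply] at this
    exact this
  simp only [h0] at h
  rcases lt_or_ge n 0 with hn | hn
  · rw [if_pos hn]
    refine h.unique ?_
    convert hasSum_zero using 1
    ext k
    rw [if_neg (show ¬ (k : ℤ) = n by omega)]; simp
  · lift n to ℕ using hn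
    refine h.unique ?_
    convert hasSum_ite_eq n (if n = 0 then (1 : ℂ) else 2 * z ^ n) using 1
    · ext k
      by_cases hk : k = n
      · subst hk
        by_cases h0 : k = 0 <;> simp [h0]
      · simp [hk]
    · simp

theorem poissonIntegral_eq {z : ℂ} (hz : ‖z‖ < 1) {u : Circ → ℂ} (hu : Integrable u leb) :
    poissonIntegral u z = (herglotz u z + conj (herglotz (fun s => conj (u s)) z)) / 2 := by
  have hu' : Integrable (fun s => conj (u s)) leb :=
    (Complex.conjCLE : ℂ →L[ℝ] ℂ).integrable_comp hu
  have h1 : conj (herglotz (fun s => conj (u s)) z) =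
      ∫ s, conj (herglotzKernel z s) * u s ∂leb := by
    rw [herglotz, ← integral_conj]
    simp
  rw [h1, herglotz, ← integral_add (integrable_herglotzKernel_mul hz hu), poissonIntegral,
    ← integral_div]
  · refine integral_congr_ae (ae_of_all _ fun s => ?_)
    simp only
    rw [Complex.re_eq_add_conj]
    ring
  · exact hu.bdd_mul (Complex.continuous_conj.comp
      (continuous_herglotzKernel hz)).aestronglyMeasurable
      (ae_of_all _ fun s => by simpa using norm_herglotzKernel_le hz s)

theorem poissonIntegral_ofReal {z : ℂ} (hz : ‖z‖ < 1) {u : Circ → ℝ} (hu : Integrable u leb) :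
    poissonIntegral (fun s => (u s : ℂ)) z = ((herglotz (fun s => (u s : ℂ)) z).re : ℂ) := by
  have hu' : Integrable (fun s => (u s : ℂ)) leb := hu.ofReal
  rw [poissonIntegral_eq hz hu', Complex.re_eq_add_conj]
  simp

theorem poissonIntegral_e {ρ : ℝ} (h0 : 0 ≤ ρ) (h1 : ρ < 1) (n : ℤ) (t : Circ) :
    poissonIntegral (e n) (ρ * e 1 t) = (ρ : ℂ) ^ n.natAbs * e n t := by
  have hz : ‖(ρ : ℂ) * e 1 t‖ < 1 := by
    rw [norm_mul, norm_e, mul_one, Complex.norm_real, Real.norm_of_nonneg h0]; exact h1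
  rw [poissonIntegral_eq hz (integrable_e n)]
  simp only [← e_neg, herglotz_e hz]
  rcases lt_trichotomy n 0 with hn | rfl | hn
  · obtain ⟨k, rfl⟩ : ∃ k : ℕ, n = -k := ⟨n.natAbs, by omega⟩
    have hk : k ≠ 0 := by omega
    have hk' : 0 < k := Nat.pos_of_ne_zero hk
    have hk2 : ¬ ((k : ℤ) < 0) := by omega
    simp only [Left.neg_neg_iff, Nat.cast_pos, hk', if_true, neg_neg, hk2, if_false,
      Nat.cast_eq_zero, hk, Int.toNat_natCast, mul_pow, e_one_pow, Int.natAbs_neg,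
      Int.natAbs_natCast, e_neg, map_mul, map_pow, Complex.conj_ofReal, map_ofNat]
    ring
  · simp [e_zero]
  · lift n to ℕ using hn.le
    have hk : n ≠ 0 := by omega
    have hk' : 0 < n := Nat.pos_of_ne_zero hk
    have hk2 : ¬ ((n : ℤ) < 0) := by omega
    simp [hk, hk', hk2, mul_pow, e_one_pow]

theorem integral_re_herglotzKernel {z : ℂ} (hz : ‖z‖ < 1) :
    ∫ s, (herglotzKernel z s).re ∂leb = 1 := by
  have h := poissonIntegral_eq hz (integrable_e 0)
  simp only [← e_neg, herglotz_e hz, neg_zero] at h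
  simp only [poissonIntegral, e_zero, mul_one, integral_complex_ofReal] at h
  norm_num at h
  exact_mod_cast h

theorem re_herglotz_le {z : ℂ} (hz : ‖z‖ < 1) {u : Circ → ℝ} (hu : Integrable u leb) {C : ℝ}
    (hC : ∀ᵐ s ∂leb, u s ≤ C) : (herglotz (fun s => (u s : ℂ)) z).re ≤ C := by
  have h1 : (herglotz (fun s => (u s : ℂ)) z).re = ∫ s, (herglotzKernel z s).re * u s ∂leb := by
    have := poissonIntegral_ofReal hz hu
    rw [poissonIntegral] at this
    rw [← Complex.ofReal_inj, ← this, ← integral_complex_ofReal]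
    simp
  have hb : ∀ s, ‖(herglotzKernel z s).re‖ ≤ 2 / (1 - ‖z‖) := fun s =>
    (Complex.abs_re_le_norm _).trans (norm_herglotzKernel_le hz s)
  have hm : Continuous fun s => (herglotzKernel z s).re :=
    Complex.continuous_re.comp (continuous_herglotzKernel hz)
  rw [h1]
  calc ∫ s, (herglotzKernel z s).re * u s ∂leb
      ≤ ∫ s, (herglotzKernel z s).re * C ∂leb := by
        refine integral_mono_ae (hu.bdd_mul hm.aestronglyMeasurable (ae_of_all _ hb))
          ((integrable_const C).bdd_mul hm.aestronglyMeasurable (ae_of_all _ hb)) ?_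
        filter_upwards [hC] with s hs
        exact mul_le_mul_of_nonneg_left hs (re_herglotzKernel_nonneg hz s)
    _ = C := by rw [integral_mul_const, integral_re_herglotzKernel hz, one_mul]

theorem norm_mul_e {ρ : ℝ} (h0 : 0 ≤ ρ) (n : ℤ) (t : Circ) : ‖(ρ : ℂ) * e n t‖ = ρ := by
  rw [norm_mul, norm_e, mul_one, Complex.norm_real, Real.norm_of_nonneg h0]

theorem norm_mul_e_lt {ρ : ℝ} (h0 : 0 ≤ ρ) (h1 : ρ < 1) (n : ℤ) (t : Circ) :
    ‖(ρ : ℂ) * e n t‖ < 1 := by rwa [norm_mul_e h0]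

/-- The restriction to a circle of radius `ρ < 1` of a function continuous in the disc. -/
theorem continuous_dilate {G : ℂ → ℂ} (hG : ContinuousOn G (Metric.ball 0 1)) {ρ : ℝ}
    (h0 : 0 ≤ ρ) (h1 : ρ < 1) : Continuous fun t : Circ => G (ρ * e 1 t) :=
  hG.comp_continuous (continuous_const.mul (continuous_e 1)) fun t =>
    mem_ball_zero_iff.2 (norm_mul_e_lt h0 h1 1 t)

theorem continuous_poissonIntegral {u : Circ → ℂ} (hu : Integrable u leb) {ρ : ℝ}
    (h0 : 0 ≤ ρ) (h1 : ρ < 1) : Continuous fun t : Circ => poissonIntegral u (ρ * e 1 t) := by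
  have hu' : Integrable (fun s => conj (u s)) leb :=
    (Complex.conjCLE : ℂ →L[ℝ] ℂ).integrable_comp hu
  simp only [fun t => poissonIntegral_eq (norm_mul_e_lt h0 h1 1 t) hu]
  exact ((continuous_dilate (differentiableOn_herglotz hu).continuousOn h0 h1).add
    (Complex.continuous_conj.comp
      (continuous_dilate (differentiableOn_herglotz hu').continuousOn h0 h1))).div_const 2

theorem re_herglotzKernel_comm (ρ : ℝ) (s t : Circ) :
    (herglotzKernel (ρ * e 1 t) s).re = (herglotzKernel (ρ * e 1 s) t).re := by
  have key : ∀ w v : ℂ, ‖w‖ = 1 → ‖v‖ = 1 →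
      ‖w - ρ * v‖ ^ 2 = 1 + ρ ^ 2 - 2 * ρ * (w.re * v.re + w.im * v.im) := by
    intro w v hw hv
    have h1 : w.re * w.re + w.im * w.im = 1 := by
      rw [← Complex.normSq_apply, Complex.normSq_eq_norm_sq, hw, one_pow]
    have h2 : v.re * v.re + v.im * v.im = 1 := by
      rw [← Complex.normSq_apply, Complex.normSq_eq_norm_sq, hv, one_pow]
    rw [← Complex.normSq_eq_norm_sq, Complex.normSq_apply]
    simp only [Complex.sub_re, Complex.sub_im, Complex.re_ofReal_mul, Complex.im_ofReal_mul]
    linear_combination h1 + ρ ^ 2 * h2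
  rw [re_herglotzKernel, re_herglotzKernel, key _ _ (norm_e 1 s) (norm_e 1 t),
    key _ _ (norm_e 1 t) (norm_e 1 s), norm_mul, norm_mul, norm_e, norm_e,
    mul_comm (e 1 s).re, mul_comm (e 1 s).im]

/-- The Poisson integral is a contraction in `L¹`: by symmetry the kernel has total mass `1` in
each of its two arguments. -/
theorem lintegral_enorm_poissonIntegral_le {u : Circ → ℂ} (hu : AEStronglyMeasurable u leb)
    {ρ : ℝ} (h0 : 0 ≤ ρ) (h1 : ρ < 1) :
    ∫⁻ t, ‖poissonIntegral u (ρ * e 1 t)‖ₑ ∂leb ≤ ∫⁻ t, ‖u t‖ₑ ∂leb := by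
  have hc : Continuous fun p : Circ × Circ => herglotzKernel (ρ * e 1 p.1) p.2 := by
    have c1 : Continuous fun p : Circ × Circ => e 1 p.1 := (continuous_e 1).comp continuous_fst
    have c2 : Continuous fun p : Circ × Circ => e 1 p.2 := (continuous_e 1).comp continuous_snd
    exact (c2.add (continuous_const.mul c1)).div (c2.sub (continuous_const.mul c1))
      fun p => e_one_sub_ne_zero (norm_mul_e_lt h0 h1 1 p.1) p.2
  have hone : ∀ s : Circ, ∫⁻ t, ‖((herglotzKernel (ρ * e 1 t) s).re : ℂ)‖ₑ ∂leb = 1 := by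
    intro s
    have hz := norm_mul_e_lt h0 h1 1 s
    have hi : Integrable (fun t => ((herglotzKernel (ρ * e 1 s) t).re : ℂ)) leb :=
      (Complex.continuous_ofReal.comp (Complex.continuous_re.comp
        (continuous_herglotzKernel hz))).integrable_of_hasCompactSupport
        (HasCompactSupport.of_compactSpace _)
    simp only [re_herglotzKernel_comm ρ s]
    rw [← ofReal_integral_norm_eq_lintegral_enorm hi]
    simp only [Complex.norm_real, Real.norm_of_nonneg (re_herglotzKernel_nonneg hz _)]
    rw [integral_re_herglotzKernel hz, ENNReal.ofReal_one]
  calc ∫⁻ t, ‖poissonIntegral u (ρ * e 1 t)‖ₑ ∂leb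
      ≤ ∫⁻ t, ∫⁻ s, ‖((herglotzKernel (ρ * e 1 t) s).re : ℂ) * u s‖ₑ ∂leb ∂leb :=
        lintegral_mono fun t => enorm_integral_le_lintegral_enorm _
    _ = ∫⁻ s, ∫⁻ t, ‖((herglotzKernel (ρ * e 1 t) s).re : ℂ) * u s‖ₑ ∂leb ∂leb := by
        refine lintegral_lintegral_swap ?_
        refine AEStronglyMeasurable.enorm ?_
        exact (Complex.continuous_ofReal.comp
          (Complex.continuous_re.comp hc)).aestronglyMeasurable.mul hu.comp_snd
    _ = ∫⁻ t, ‖u t‖ₑ ∂leb := by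
        refine lintegral_congr fun s => ?_
        simp only [enorm_mul]
        rw [lintegral_mul_const' _ _ enorm_ne_top, hone, one_mul]

theorem integrable_re_herglotzKernel_mul {z : ℂ} (hz : ‖z‖ < 1) {u : Circ → ℂ}
    (hu : Integrable u leb) : Integrable (fun s => ((herglotzKernel z s).re : ℂ) * u s) leb :=
  hu.bdd_mul (c := 2 / (1 - ‖z‖)) (Complex.continuous_ofReal.comp (Complex.continuous_re.comp
    (continuous_herglotzKernel hz))).aestronglyMeasurable
    (ae_of_all _ fun s => by
      rw [Complex.norm_real]
      exact (Complex.abs_re_le_norm _).trans (norm_herglotzKernel_le hz s))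

theorem poissonIntegral_add {z : ℂ} (hz : ‖z‖ < 1) {u v : Circ → ℂ} (hu : Integrable u leb)
    (hv : Integrable v leb) :
    poissonIntegral (fun s => u s + v s) z = poissonIntegral u z + poissonIntegral v z := by
  rw [poissonIntegral, poissonIntegral, poissonIntegral,
    ← integral_add (integrable_re_herglotzKernel_mul hz hu)
      (integrable_re_herglotzKernel_mul hz hv)]
  simp only [mul_add]

theorem poissonIntegral_congr_ae {u v : Circ → ℂ} (h : u =ᵐ[leb] v) (z : ℂ) :
    poissonIntegral u z = poissonIntegral v z :=
  integral_congr_ae (h.mono fun s hs => by simp only [hs])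

/-- The `L¹` distance from `u` to its Poisson integral on the circle of radius `ρ`. -/
noncomputable def poissonError (u : Circ → ℂ) (ρ : ℝ) : ENNReal :=
  ∫⁻ t, ‖poissonIntegral u (ρ * e 1 t) - u t‖ₑ ∂leb

theorem poissonError_congr_ae {u v : Circ → ℂ} (h : u =ᵐ[leb] v) (ρ : ℝ) :
    poissonError u ρ = poissonError v ρ :=
  lintegral_congr_ae (h.mono fun t ht => by simp only [ht, poissonIntegral_congr_ae h])

theorem poissonError_add_le {u v : Circ → ℂ} (hu : Integrable u leb) (hv : Integrable v leb)
    {ρ : ℝ} (h0 : 0 ≤ ρ) (h1 : ρ < 1) :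
    poissonError (fun t => u t + v t) ρ ≤ poissonError u ρ + poissonError v ρ := by
  have hm : AEMeasurable (fun t => ‖poissonIntegral u (ρ * e 1 t) - u t‖ₑ) leb :=
    ((continuous_poissonIntegral hu h0 h1).aestronglyMeasurable.sub hu.1).enorm
  rw [poissonError, poissonError, poissonError, ← lintegral_add_left' hm]
  refine lintegral_mono fun t => ?_
  simp only [poissonIntegral_add (norm_mul_e_lt h0 h1 1 t) hu hv]
  rw [add_sub_add_comm]
  exact enorm_add_le _ _

theorem poissonError_le {u : Circ → ℂ} (hu : Integrable u leb) {ρ : ℝ} (h0 : 0 ≤ ρ)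
    (h1 : ρ < 1) : poissonError u ρ ≤ 2 * ∫⁻ t, ‖u t‖ₑ ∂leb := by
  calc poissonError u ρ
      ≤ ∫⁻ t, (‖poissonIntegral u (ρ * e 1 t)‖ₑ + ‖u t‖ₑ) ∂leb :=
        lintegral_mono fun t => enorm_sub_le
    _ = ∫⁻ t, ‖poissonIntegral u (ρ * e 1 t)‖ₑ ∂leb + ∫⁻ t, ‖u t‖ₑ ∂leb :=
        lintegral_add_right' _ hu.1.enorm
    _ ≤ _ := by
        rw [two_mul]
        exact add_le_add_left (lintegral_enorm_poissonIntegral_le hu.1 h0 h1) _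

theorem poissonError_smul (c : ℂ) (u : Circ → ℂ) (ρ : ℝ) :
    poissonError (fun t => c * u t) ρ = ‖c‖ₑ * poissonError u ρ := by
  rw [poissonError, poissonError, ← lintegral_const_mul' _ _ enorm_ne_top]
  refine lintegral_congr fun t => ?_
  rw [← enorm_mul, mul_sub]
  congr 2
  rw [poissonIntegral, poissonIntegral, ← integral_const_mul]
  congr 1
  ext s
  ring

theorem eventually_radius : ∀ᶠ ρ : ℝ in 𝓝[<] 1, 0 ≤ ρ ∧ ρ < 1 :=
  (Ico_mem_nhdsLT zero_lt_one : Set.Ico (0 : ℝ) 1 ∈ 𝓝[<] 1)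

theorem tendsto_poissonError_e (n : ℤ) : Tendsto (poissonError (e n)) (𝓝[<] 1) (𝓝 0) := by
  have h : Tendsto (fun ρ : ℝ => ‖(ρ : ℂ) ^ n.natAbs - 1‖ₑ) (𝓝[<] 1) (𝓝 0) := by
    have hc : Continuous fun ρ : ℝ => ‖(ρ : ℂ) ^ n.natAbs - 1‖ₑ := by fun_prop
    have := hc.tendsto 1
    simp only [Complex.ofReal_one, one_pow, sub_self, enorm_zero] at this
    exact this.mono_left nhdsWithin_le_nhds
  refine h.congr' ?_
  filter_upwards [eventually_radius] with ρ hρ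
  rw [poissonError]
  have : ∀ t : Circ, ‖(ρ : ℂ) ^ n.natAbs * e n t - e n t‖ₑ = ‖(ρ : ℂ) ^ n.natAbs - 1‖ₑ := by
    intro t
    rw [← sub_one_mul, enorm_mul]
    have h1 : ‖e n t‖ₑ = 1 := by rw [← ofReal_norm, norm_e, ENNReal.ofReal_one]
    rw [h1, mul_one]
  simp only [poissonIntegral_e hρ.1 hρ.2, this, lintegral_const, measure_univ, mul_one]

/-- Poisson integrals converge in `L¹`: by the contraction property it suffices to check this for
the characters, whose span is dense. -/
theorem tendsto_poissonError {u : Circ → ℂ} (hu : Integrable u leb) :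
    Tendsto (poissonError u) (𝓝[<] 1) (𝓝 0) := by
  have hspan : ∀ p ∈ Submodule.span ℂ (Set.range (fourierLp (T := 1) 1)),
      Tendsto (poissonError p) (𝓝[<] 1) (𝓝 0) := by
    intro p hp
    induction hp using Submodule.span_induction with
    | mem x hx =>
      obtain ⟨n, rfl⟩ := hx
      refine (tendsto_poissonError_e n).congr fun ρ => ?_
      exact poissonError_congr_ae (coeFn_fourierLp 1 n).symm ρ
    | zero =>
      refine tendsto_const_nhds.congr fun ρ => ?_
      rw [poissonError_congr_ae (Lp.coeFn_zero ℂ 1 leb)]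
      simp [poissonError, poissonIntegral]
    | add x y _ _ hx hy =>
      have h := hx.add hy
      rw [add_zero] at h
      refine tendsto_of_tendsto_of_tendsto_of_le_of_le' tendsto_const_nhds h
        (Eventually.of_forall fun _ => zero_le) ?_
      filter_upwards [eventually_radius] with ρ hρ
      rw [poissonError_congr_ae (Lp.coeFn_add x y)]
      exact poissonError_add_le (L1.integrable_coeFn x) (L1.integrable_coeFn y) hρ.1 hρ.2
    | smul c x _ hx =>
      have h := ENNReal.Tendsto.const_mul (a := ‖c‖ₑ) hx (Or.inr enorm_ne_top)
      rw [mul_zero] at h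
      refine h.congr fun ρ => ?_
      rw [poissonError_congr_ae (Lp.coeFn_smul c x)]
      exact (poissonError_smul c x ρ).symm
  rw [ENNReal.tendsto_nhds_zero]
  intro δ hδ
  obtain ⟨η, hη, hηδ⟩ : ∃ η : NNReal, 0 < η ∧ 3 * (η : ENNReal) ≤ δ := by
    rcases eq_or_ne δ ⊤ with rfl | hδt
    · exact ⟨1, one_pos, le_top⟩
    · lift δ to NNReal using hδt
      refine ⟨δ / 3, by simpa using hδ, ?_⟩
      rw [← ENNReal.coe_ofNat, ← ENNReal.coe_mul, mul_div_cancel₀ _ (by norm_num)]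
  have hmem : hu.toL1 ∈
      (Submodule.span ℂ (Set.range (fourierLp (T := 1) 1))).topologicalClosure := by
    rw [span_fourierLp_closure_eq_top ENNReal.one_ne_top]; trivial
  obtain ⟨p, hp, hup⟩ := Metric.mem_closure_iff.1 hmem η (by exact_mod_cast hη)
  have hpi := L1.integrable_coeFn p
  have hupe : ∫⁻ t, ‖u t - p t‖ₑ ∂leb ≤ η := by
    have h1 : edist (hu.toL1 u) p ≤ η := by
      rw [edist_dist]
      exact ENNReal.ofReal_le_of_le_toReal hup.le
    rw [Lp.edist_def, eLpNorm_one_eq_lintegral_enorm] at h1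
    refine le_trans (le_of_eq ?_) h1
    refine lintegral_congr_ae ?_
    filter_upwards [hu.coeFn_toL1] with t ht
    rw [Pi.sub_apply, ht]
  filter_upwards [eventually_radius,
    (ENNReal.tendsto_nhds_zero.1 (hspan p hp)) η (by exact_mod_cast hη)] with ρ hρ hpρ
  calc poissonError u ρ = poissonError (fun t => p t + (u t - p t)) ρ := by simp
    _ ≤ poissonError p ρ + poissonError (fun t => u t - p t) ρ :=
      poissonError_add_le hpi (hu.sub hpi) hρ.1 hρ.2
    _ ≤ η + 2 * η := by
      gcongr
      exact (poissonError_le (hu.sub hpi) hρ.1 hρ.2).trans (mul_le_mul_right hupe 2)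
    _ = 3 * η := by ring
    _ ≤ δ := hηδ

/-- Along a suitable sequence of radii, the Poisson integral of `u` converges to `u` almost
everywhere. -/
theorem exists_radii_tendsto_re_herglotz {u : Circ → ℝ} (hu : Integrable u leb) :
    ∃ ρ : ℕ → ℝ, (∀ k, 0 ≤ ρ k ∧ ρ k < 1) ∧ Tendsto ρ atTop (𝓝[<] 1) ∧
      ∀ᵐ t ∂leb, Tendsto (fun k => (herglotz (fun s => (u s : ℂ)) (ρ k * e 1 t)).re) atTop
        (𝓝 (u t)) := by
  have hu' : Integrable (fun s => (u s : ℂ)) leb := hu.ofReal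
  set ρ : ℕ → ℝ := fun k => 1 - 1 / ((k : ℝ) + 1)
  have hρ : ∀ k, 0 ≤ ρ k ∧ ρ k < 1 := fun k => by
    have h1 : (0 : ℝ) < 1 / ((k : ℝ) + 1) := by positivity
    have h2 : 1 / ((k : ℝ) + 1) ≤ 1 := by
      rw [div_le_one (by positivity)]; linarith [Nat.cast_nonneg (α := ℝ) k]
    exact ⟨sub_nonneg.2 h2, sub_lt_self _ h1⟩
  have hlim : Tendsto ρ atTop (𝓝[<] 1) := by
    refine tendsto_nhdsWithin_iff.2 ⟨?_, Eventually.of_forall fun k => (hρ k).2⟩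
    have := (tendsto_const_nhds (x := (1 : ℝ))).sub
      (tendsto_one_div_add_atTop_nhds_zero_nat (𝕜 := ℝ))
    rwa [sub_zero] at this
  have hm : TendstoInMeasure leb
      (fun k t => poissonIntegral (fun s => (u s : ℂ)) (ρ k * e 1 t)) atTop
      fun t => (u t : ℂ) := by
    refine tendstoInMeasure_of_tendsto_eLpNorm one_ne_zero (fun k =>
      (continuous_poissonIntegral hu' (hρ k).1 (hρ k).2).aestronglyMeasurable) hu'.1 ?_
    refine ((tendsto_poissonError hu').comp hlim).congr fun k => ?_
    rw [eLpNorm_one_eq_lintegral_enorm]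
    rfl
  obtain ⟨ns, hns, hae⟩ := hm.exists_seq_tendsto_ae
  refine ⟨fun k => ρ (ns k), fun k => hρ _, hlim.comp hns.tendsto_atTop, ?_⟩
  filter_upwards [hae] with t ht
  have := (Complex.continuous_re.tendsto _).comp ht
  refine this.congr fun k => ?_
  rw [Function.comp_apply, poissonIntegral_ofReal (norm_mul_e_lt (hρ _).1 (hρ _).2 1 t) hu,
    Complex.ofReal_re]

/-! ### Analytic functions on smaller circles -/

/-- The partial sums of the Taylor series approximate an analytic function uniformly on a smaller
circle. -/
theorem exists_trigPoly_approx {G : ℂ → ℂ} (hG : DifferentiableOn ℂ G (Metric.ball 0 1)) {ρ : ℝ}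
    (h0 : 0 ≤ ρ) (h1 : ρ < 1) {δ : ℝ} (hδ : 0 < δ) :
    ∃ (n : ℕ) (a : ℕ → ℂ), a 0 = G 0 ∧
      ∀ t : Circ, ‖G (ρ * e 1 t) - ∑ k ∈ Finset.range (n + 1), a k * e k t‖ < δ := by
  set a : ℕ → ℂ := fun k => (k.factorial : ℂ)⁻¹ * ((ρ : ℂ) ^ k * iteratedDeriv k G 0) with ha
  have hsum : ∀ t : Circ, HasSum (fun k => a k * e k t) (G (ρ * e 1 t)) := fun t => by
    have h := Complex.hasSum_taylorSeries_on_ball hG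
      (mem_ball_zero_iff.2 (norm_mul_e_lt h0 h1 1 t))
    refine Eq.mpr (congrArg (fun f => HasSum f _) (funext fun k => ?_)) h
    simp only [ha, sub_zero, mul_pow, e_one_pow, smul_eq_mul]
    ring
  have hs : Summable fun k => ‖a k‖ := by
    have := (hsum 0).summable.norm
    simpa only [norm_mul, norm_e, mul_one] using this
  have hu := tendstoUniformly_tsum_nat (f := fun k (t : Circ) => a k * e k t) hs
    fun k t => by rw [norm_mul, norm_e, mul_one]
  obtain ⟨N, hN⟩ := (Metric.tendstoUniformly_iff.1 hu δ hδ).exists_forall_of_atTop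
  refine ⟨N, a, by simp [ha], fun t => ?_⟩
  have := hN (N + 1) N.le_succ t
  rwa [(hsum t).tsum_eq, dist_eq_norm] at this

/-- The mean value property for the product of an analytic function with a function in `H²`. -/
theorem integral_dilate_mul {G : ℂ → ℂ} (hG : DifferentiableOn ℂ G (Metric.ball 0 1)) {ρ : ℝ}
    (h0 : 0 ≤ ρ) (h1 : ρ < 1) {φ : Circ → ℂ} (hφ : MemH2 φ) :
    ∫ t, G (ρ * e 1 t) * φ t ∂leb = G 0 * ∫ t, φ t ∂leb := by
  have hφi : Integrable φ leb := hφ.1.integrable one_le_two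
  have hzero : ∀ k : ℕ, ∫ t, e k t * φ t ∂leb = if k = 0 then ∫ t, φ t ∂leb else 0 := by
    intro k
    split_ifs with hk
    · subst hk; simp [e_zero]
    · have h2 := hφ.2 (-k) (by omega)
      rw [fourierCoeff, neg_neg] at h2
      exact h2
  have hint : ∀ k : ℕ, Integrable (fun t => e k t * φ t) leb := fun k =>
    hφi.bdd_mul (continuous_e k).aestronglyMeasurable
      (ae_of_all _ fun t => (norm_e k t).le)
  have key : ∀ δ > 0, ‖∫ t, G (ρ * e 1 t) * φ t ∂leb - G 0 * ∫ t, φ t ∂leb‖ ≤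
      δ * ∫ t, ‖φ t‖ ∂leb := by
    intro δ hδ
    obtain ⟨n, a, ha, hn⟩ := exists_trigPoly_approx hG h0 h1 hδ
    have h3 : ∫ t, (∑ k ∈ Finset.range (n + 1), a k * e k t) * φ t ∂leb =
        G 0 * ∫ t, φ t ∂leb := by
      simp only [Finset.sum_mul, mul_assoc]
      rw [integral_finsetSum _ fun k _ => (hint k).const_mul _]
      simp only [integral_const_mul, hzero]
      rw [Finset.sum_range_succ', Finset.sum_eq_zero] <;> simp [ha]
    have hGi : Integrable (fun t => G (ρ * e 1 t) * φ t) leb := by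
      obtain ⟨C, hC⟩ := (isCompact_range
        (continuous_dilate hG.continuousOn h0 h1)).isBounded.exists_norm_le
      exact hφi.bdd_mul (continuous_dilate hG.continuousOn h0 h1).aestronglyMeasurable
        (ae_of_all _ fun t => hC _ ⟨t, rfl⟩)
    have hSi : Integrable (fun t => (∑ k ∈ Finset.range (n + 1), a k * e k t) * φ t) leb := by
      simp only [Finset.sum_mul, mul_assoc]
      exact integrable_finsetSum _ fun k _ => (hint k).const_mul _
    rw [← h3, ← integral_sub hGi hSi, ← integral_const_mul]
    refine norm_integral_le_of_norm_le (hφi.norm.const_mul δ) (ae_of_all _ fun t => ?_)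
    rw [← sub_mul, norm_mul]
    have := (hn t).le
    gcongr
  rw [← sub_eq_zero, ← norm_le_zero_iff]
  have h4 : Tendsto (fun δ : ℝ => δ * ∫ t, ‖φ t‖ ∂leb) (𝓝[>] 0) (𝓝 0) := by
    have := (tendsto_id (x := 𝓝 (0 : ℝ))).mul_const (∫ t, ‖φ t‖ ∂leb)
    rw [zero_mul] at this
    exact this.mono_left nhdsWithin_le_nhds
  exact ge_of_tendsto h4 (eventually_mem_nhdsWithin.mono key)

/-! ### Outer functions are cyclic in `H²` -/

/-- The outer function `exp (H u / 2)` of the disc, where `H u` is the Herglotz integral of `u`;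
its squared modulus has boundary values `exp u`. -/
noncomputable def outerOf (u : Circ → ℝ) (z : ℂ) : ℂ :=
  Complex.exp ((1 / 2 : ℂ) * herglotz (fun s => (u s : ℂ)) z)

theorem outerExt_eq_outerOf (f : Circ → ℝ) :
    outerExt f = outerOf fun t => Real.log (f t) := rfl

theorem differentiableOn_outerOf {u : Circ → ℝ} (hu : Integrable u leb) :
    DifferentiableOn ℂ (outerOf u) (Metric.ball 0 1) :=
  ((differentiableOn_herglotz (u := fun s => (u s : ℂ)) hu.ofReal).const_mul _).cexp

theorem norm_outerOf_sq (u : Circ → ℝ) (z : ℂ) :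
    ‖outerOf u z‖ ^ 2 = Real.exp (herglotz (fun s => (u s : ℂ)) z).re := by
  rw [outerOf, Complex.norm_exp, ← Real.exp_nat_mul]
  congr 1
  simp

theorem norm_outerOf_sq_le {u : Circ → ℝ} (hu : Integrable u leb) {C : ℝ}
    (hC : ∀ᵐ t ∂leb, u t ≤ C) {z : ℂ} (hz : ‖z‖ < 1) : ‖outerOf u z‖ ^ 2 ≤ Real.exp C := by
  rw [norm_outerOf_sq]
  exact Real.exp_le_exp.2 (re_herglotz_le hz hu hC)

theorem norm_outerOf_le_one {u : Circ → ℝ} (hu : Integrable u leb)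
    (h0 : ∀ᵐ t ∂leb, u t ≤ 0) {z : ℂ} (hz : ‖z‖ < 1) : ‖outerOf u z‖ ≤ 1 := by
  have := norm_outerOf_sq_le hu h0 hz
  rw [Real.exp_zero] at this
  exact (sq_le_one_iff₀ (norm_nonneg _)).1 this

theorem outerOf_add {u v : Circ → ℝ} (hu : Integrable u leb) (hv : Integrable v leb) {z : ℂ}
    (hz : ‖z‖ < 1) : outerOf (fun t => u t + v t) z = outerOf u z * outerOf v z := by
  have h := herglotz_add hz (u := fun s => (u s : ℂ)) (v := fun s => (v s : ℂ)) hu.ofReal hv.ofReal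
  simp only [outerOf, Complex.ofReal_add]
  rw [h, mul_add, Complex.exp_add]

theorem outerOf_zero (u : Circ → ℝ) :
    outerOf u 0 = (Real.exp (1 / 2 * ∫ t, u t ∂leb) : ℝ) := by
  rw [outerOf, herglotz_zero, integral_complex_ofReal]
  push_cast
  rfl

theorem outerOf_ne_zero (u : Circ → ℝ) (z : ℂ) : outerOf u z ≠ 0 := Complex.exp_ne_zero _

theorem memH2_one : MemH2 fun _ => 1 := by
  refine ⟨memLp_const 1, fun n hn => ?_⟩
  have h : (fun _ : Circ => (1 : ℂ)) = fourier 0 := by ext t; exact (e_zero t).symm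
  rw [h, fourierCoeff_fourier, Pi.single_apply, if_neg hn.ne]

/-- Radial limits of outer functions have the prescribed modulus. -/
theorem norm_sq_eq_of_radial_limit {φ : Circ → ℂ} {c : ℂ} (hc : ‖c‖ = 1) {u : Circ → ℝ}
    (hu : Integrable u leb)
    (hlim : ∀ᵐ t ∂leb, Tendsto (fun r : ℝ => c * outerOf u ((r : ℂ) * e 1 t)) (𝓝[<] 1)
      (𝓝 (φ t))) :
    ∀ᵐ t ∂leb, ‖φ t‖ ^ 2 = Real.exp (u t) := by
  obtain ⟨ρ, -, hρ1, hae⟩ := exists_radii_tendsto_re_herglotz hu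
  filter_upwards [hlim, hae] with t h1 h2
  have h3 := ((h1.comp hρ1).norm.pow 2)
  refine tendsto_nhds_unique h3 (((Real.continuous_exp.tendsto _).comp h2).congr fun k => ?_)
  simp [hc, norm_outerOf_sq]

theorem IsOuter.ae_ne_zero {φ : Circ → ℂ} (h : IsOuter φ) : ∀ᵐ t ∂leb, φ t ≠ 0 := by
  obtain ⟨c, f, hc, -, hint, hlim⟩ := h
  filter_upwards [norm_sq_eq_of_radial_limit hc hint hlim] with t ht h0
  rw [h0, norm_zero] at ht
  exact (Real.exp_pos _).ne (by simpa using ht)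

/-- The mean of an `H²` function with outer radial limits is the value at the origin of its outer
extension. The auxiliary outer function with exponent `min (-u) 0` makes both
the boundary function and the dilates of the extension bounded by integrable functions. -/
theorem integral_eq_of_radial_limit {φ : Circ → ℂ} (hφ : MemH2 φ) {c : ℂ} (hc : ‖c‖ = 1)
    {u : Circ → ℝ} (hu : Integrable u leb)
    (hlim : ∀ᵐ t ∂leb, Tendsto (fun r : ℝ => c * outerOf u ((r : ℂ) * e 1 t)) (𝓝[<] 1)
      (𝓝 (φ t))) :
    ∫ t, φ t ∂leb = c * outerOf u 0 := by
  have hφi : Integrable φ leb := hφ.1.integrable one_le_two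
  set m : Circ → ℝ := fun t => min (-u t) 0
  have hm : Integrable m leb := hu.neg.inf (integrable_zero _ _ _)
  have hmu : Integrable (fun t => m t + u t) leb := hm.add hu
  have hm0 : ∀ᵐ t ∂leb, m t ≤ 0 := ae_of_all _ fun t => min_le_right _ _
  have hmu0 : ∀ᵐ t ∂leb, m t + u t ≤ 0 := ae_of_all _ fun t => by
    linarith [min_le_left (-u t) 0]
  have hGm := differentiableOn_outerOf hm
  have hGu := differentiableOn_outerOf hu
  have h1 : Tendsto (fun ρ : ℝ => ∫ t, outerOf m (ρ * e 1 t) *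
      (φ t - c * outerOf u (ρ * e 1 t)) ∂leb) (𝓝[<] 1) (𝓝 (∫ _, (0 : ℂ) ∂leb)) := by
    refine tendsto_integral_filter_of_dominated_convergence (fun t => ‖φ t‖ + 1) ?_ ?_
      (hφi.norm.add (integrable_const 1)) ?_
    · filter_upwards [eventually_radius] with ρ hρ
      exact (continuous_dilate hGm.continuousOn hρ.1 hρ.2).aestronglyMeasurable.mul
        (hφi.1.sub (continuous_const.mul
          (continuous_dilate hGu.continuousOn hρ.1 hρ.2)).aestronglyMeasurable)
    · filter_upwards [eventually_radius] with ρ hρ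
      refine ae_of_all _ fun t => ?_
      have hz := norm_mul_e_lt hρ.1 hρ.2 1 t
      have h2 := norm_outerOf_le_one hm hm0 hz
      have h3 := norm_outerOf_le_one hmu hmu0 hz
      rw [outerOf_add hm hu hz] at h3
      rw [mul_sub]
      refine (norm_sub_le _ _).trans (add_le_add ?_ ?_)
      · rw [norm_mul]
        exact mul_le_of_le_one_left (norm_nonneg _) h2
      · rwa [mul_left_comm, norm_mul, hc, one_mul]
    · filter_upwards [hlim] with t ht
      rw [tendsto_zero_iff_norm_tendsto_zero]
      have h4 : Tendsto (fun ρ : ℝ => ‖φ t - c * outerOf u (ρ * e 1 t)‖) (𝓝[<] 1) (𝓝 0) := by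
        have := ((tendsto_const_nhds (x := φ t)).sub ht).norm
        rwa [sub_self, norm_zero] at this
      refine tendsto_of_tendsto_of_tendsto_of_le_of_le' tendsto_const_nhds h4
        (Eventually.of_forall fun _ => norm_nonneg _) ?_
      filter_upwards [eventually_radius] with ρ hρ
      rw [norm_mul]
      exact mul_le_of_le_one_left (norm_nonneg _)
        (norm_outerOf_le_one hm hm0 (norm_mul_e_lt hρ.1 hρ.2 1 t))
  rw [integral_zero] at h1
  -- By the mean value property these integrals do not depend on `ρ`, so they all vanish.
  have h5 : (fun ρ : ℝ => ∫ t, outerOf m (ρ * e 1 t) * (φ t - c * outerOf u (ρ * e 1 t)) ∂leb)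
      =ᶠ[𝓝[<] 1] fun _ => outerOf m 0 * (∫ t, φ t ∂leb - c * outerOf u 0) := by
    filter_upwards [eventually_radius] with ρ hρ
    have hcm := continuous_dilate hGm.continuousOn hρ.1 hρ.2
    have hcu := continuous_dilate hGu.continuousOn hρ.1 hρ.2
    have h6 : ∫ t, outerOf m (ρ * e 1 t) * outerOf u (ρ * e 1 t) ∂leb =
        outerOf m 0 * outerOf u 0 := by
      have h7 := integral_dilate_mul (differentiableOn_outerOf hmu) hρ.1 hρ.2 memH2_one
      simp only [mul_one, integral_const, probReal_univ, one_smul] at h7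
      rw [outerOf_add hm hu (by simp)] at h7
      rw [← h7]
      refine integral_congr_ae (ae_of_all _ fun t => ?_)
      exact (outerOf_add hm hu (norm_mul_e_lt hρ.1 hρ.2 1 t)).symm
    have h8 : ∀ t, outerOf m (ρ * e 1 t) * (φ t - c * outerOf u (ρ * e 1 t)) =
        outerOf m (ρ * e 1 t) * φ t - c * (outerOf m (ρ * e 1 t) * outerOf u (ρ * e 1 t)) :=
      fun t => by ring
    simp only [h8]
    rw [integral_sub, integral_const_mul, h6, integral_dilate_mul hGm hρ.1 hρ.2 hφ]
    · ring
    · exact hφi.bdd_mul (c := 1) hcm.aestronglyMeasurable (ae_of_all _ fun t =>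
        norm_outerOf_le_one hm hm0 (norm_mul_e_lt hρ.1 hρ.2 1 t))
    · exact (continuous_const.mul (hcm.mul hcu)).integrable_of_hasCompactSupport
        (HasCompactSupport.of_compactSpace _)
  have h9 := tendsto_nhds_unique (tendsto_const_nhds.congr' h5.symm) h1
  exact sub_eq_zero.1 ((mul_eq_zero.1 h9).resolve_left (outerOf_ne_zero _ _))

theorem tendsto_integral_min_add_nat {u : Circ → ℝ} (hu : Integrable u leb) :
    Tendsto (fun N : ℕ => ∫ t, min 0 (u t + N) ∂leb) atTop (𝓝 0) := by
  have h : Tendsto (fun N : ℕ => ∫ t, min 0 (u t + N) ∂leb) atTop (𝓝 (∫ _, (0 : ℝ) ∂leb)) := by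
    refine tendsto_integral_of_dominated_convergence (fun t => |u t|) (fun N => ?_) hu.abs
      (fun N => ae_of_all _ fun t => ?_) (ae_of_all _ fun t => ?_)
    · exact aestronglyMeasurable_const.inf (hu.1.add aestronglyMeasurable_const)
    · rw [Real.norm_eq_abs, abs_of_nonpos (min_le_left _ _), neg_le]
      have := neg_abs_le (u t)
      exact le_min (by linarith [abs_nonneg (u t)]) (by linarith [Nat.cast_nonneg (α := ℝ) N])
    · refine tendsto_const_nhds.congr' ?_
      filter_upwards [eventually_ge_atTop ⌈-u t⌉₊] with N hN
      rw [min_eq_left]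
      linarith [Nat.ceil_le.1 hN]
  rwa [integral_zero] at h

theorem integrable_norm_sq {φ : Circ → ℂ} (hφ : MemLp φ 2 leb) :
    Integrable (fun t => ‖φ t‖ ^ 2) leb :=
  (memLp_two_iff_integrable_sq_norm hφ.1).1 hφ

theorem memLp_continuous_mul {g φ : Circ → ℂ} (hg : Continuous g) (hφ : MemLp φ 2 leb) :
    MemLp (fun t => g t * φ t) 2 leb := by
  obtain ⟨C, hC⟩ := (isCompact_range hg).isBounded.exists_norm_le
  refine (hφ.const_mul (C : ℂ)).mono (hg.aestronglyMeasurable.mul hφ.1) (ae_of_all _ fun t => ?_)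
  rw [norm_mul, norm_mul]
  refine mul_le_mul_of_nonneg_right ?_ (norm_nonneg _)
  exact (hC _ ⟨t, rfl⟩).trans (by rw [Complex.norm_real]; exact le_abs_self C)

theorem integral_norm_sub_const_sq {h : Circ → ℂ} (hh : MemLp h 2 leb) {c : ℂ} (hc : ‖c‖ = 1) :
    ∫ t, ‖h t - c‖ ^ 2 ∂leb = ∫ t, ‖h t‖ ^ 2 ∂leb - 2 * (conj c * ∫ t, h t ∂leb).re + 1 := by
  have hi : Integrable h leb := hh.integrable one_le_two
  have i1 := integrable_norm_sq hh
  have i2 : Integrable (fun t => 2 * (conj c * h t).re) leb :=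
    (hi.const_mul (conj c)).re.const_mul 2
  have i3 : Integrable (fun t => ‖h t‖ ^ 2 - 2 * (conj c * h t).re) leb := i1.sub i2
  have h1 : ∀ t, ‖h t - c‖ ^ 2 = ‖h t‖ ^ 2 - 2 * (conj c * h t).re + 1 := by
    intro t
    have h2 := norm_sub_sq (𝕜 := ℂ) (h t) c
    rw [hc, one_pow] at h2
    have h3 : RCLike.re (inner ℂ (h t) c) = (conj c * h t).re := by
      rw [RCLike.inner_apply, RCLike.re_to_complex, ← Complex.conj_re, map_mul, Complex.conj_conj]
    rw [h2, h3]
  have h4 : ∫ t, (conj c * h t).re ∂leb = (conj c * ∫ t, h t ∂leb).re := by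
    rw [← integral_const_mul]
    exact integral_re (hi.const_mul (conj c))
  simp only [h1]
  rw [integral_add i3 (integrable_const 1), integral_sub i1 i2, integral_const_mul, h4]
  simp

/-- With `G` the outer function with exponent `min (-log |φ|²) N`, the products of `φ` with
dilates of `G` have norm at most `1` in the limit, and their mean tends to a number of modulus `1`
as `N → ∞`, so that they come close to a constant. -/
theorem IsOuter.exists_dilate_mul_sub_const {φ : Circ → ℂ} (hφ : MemH2 φ) (ho : IsOuter φ)
    {δ : ℝ} (hδ : 0 < δ) :
    ∃ c : ℂ, ‖c‖ = 1 ∧ ∃ G : ℂ → ℂ, DifferentiableOn ℂ G (Metric.ball 0 1) ∧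
      ∃ ρ : ℝ, 0 ≤ ρ ∧ ρ < 1 ∧ ∫ t, ‖G (ρ * e 1 t) * φ t - c‖ ^ 2 ∂leb < δ := by
  obtain ⟨c, f, hc, -, hu, hlim⟩ := ho
  rw [outerExt_eq_outerOf] at hlim
  generalize (fun t => Real.log (f t)) = u at hu hlim
  have hφ2 := integrable_norm_sq hφ.1
  have hmod := norm_sq_eq_of_radial_limit hc hu hlim
  have hmean := integral_eq_of_radial_limit hφ hc hu hlim
  obtain ⟨N, hN⟩ : ∃ N : ℕ, 1 - δ / 4 < Real.exp (1 / 2 * ∫ t, min 0 (u t + N) ∂leb) := by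
    have h1 := (Real.continuous_exp.tendsto _).comp
      ((tendsto_integral_min_add_nat hu).const_mul (1 / 2))
    rw [mul_zero, Real.exp_zero] at h1
    exact (h1.eventually (lt_mem_nhds (show 1 - δ / 4 < 1 by linarith))).exists
  set m : Circ → ℝ := fun t => min (-u t) N with hmdef
  have hm : Integrable m leb := hu.neg.inf (integrable_const _)
  have hmN : ∀ᵐ t ∂leb, m t ≤ N := ae_of_all _ fun t => min_le_right _ _
  have hG := differentiableOn_outerOf hm
  obtain ⟨ρ, hρ, -, hae⟩ := exists_radii_tendsto_re_herglotz hm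
  have hlim2 : Tendsto (fun k => ∫ t, ‖outerOf m (ρ k * e 1 t) * φ t‖ ^ 2 ∂leb) atTop
      (𝓝 (∫ t, Real.exp (m t) * ‖φ t‖ ^ 2 ∂leb)) := by
    refine tendsto_integral_of_dominated_convergence (fun t => Real.exp N * ‖φ t‖ ^ 2)
      (fun k => ?_) (hφ2.const_mul _) (fun k => ae_of_all _ fun t => ?_) ?_
    · exact ((continuous_dilate hG.continuousOn (hρ k).1 (hρ k).2).aestronglyMeasurable.mul
        hφ.1.1).norm.pow 2
    · rw [Real.norm_of_nonneg (by positivity), norm_mul, mul_pow]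
      have := norm_outerOf_sq_le hm hmN (norm_mul_e_lt (hρ k).1 (hρ k).2 1 t)
      gcongr
    · filter_upwards [hae] with t ht
      simp only [norm_mul, mul_pow, norm_outerOf_sq]
      exact ((Real.continuous_exp.tendsto _).comp ht).mul_const _
  -- `exp (m) |φ|² ≤ exp (-u) exp u = 1`.
  have hle : ∫ t, Real.exp (m t) * ‖φ t‖ ^ 2 ∂leb ≤ 1 := by
    refine (integral_mono_of_nonneg (ae_of_all _ fun t => by positivity) (integrable_const 1)
      ?_).trans (by simp)
    filter_upwards [hmod] with t ht
    rw [ht, ← Real.exp_add, ← Real.exp_zero]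
    exact Real.exp_le_exp.2 (by linarith [min_le_left (-u t) (N : ℝ)])
  obtain ⟨k, hk⟩ := (hlim2.eventually
    (gt_mem_nhds (show _ < 1 + δ / 2 by linarith))).exists
  refine ⟨c, hc, outerOf m, hG, ρ k, (hρ k).1, (hρ k).2, ?_⟩
  have hgmean : conj c * ∫ t, outerOf m (ρ k * e 1 t) * φ t ∂leb =
      (Real.exp (1 / 2 * ∫ t, min 0 (u t + N) ∂leb) : ℝ) := by
    rw [integral_dilate_mul hG (hρ k).1 (hρ k).2 hφ, hmean]
    have h3 : conj c * c = 1 := by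
      rw [mul_comm, Complex.mul_conj, Complex.normSq_eq_norm_sq, hc]; simp
    have h4 := outerOf_add hm hu (z := 0) (by simp)
    have h5 : (fun t => m t + u t) = fun t => min 0 (u t + N) := by
      ext t
      rw [hmdef, ← min_add_add_right, neg_add_cancel, add_comm]
    rw [h5, outerOf_zero] at h4
    rw [h4]
    linear_combination (outerOf m 0 * outerOf u 0) * h3
  rw [integral_norm_sub_const_sq (memLp_continuous_mul
    (continuous_dilate hG.continuousOn (hρ k).1 (hρ k).2) hφ.1) hc, hgmean, Complex.ofReal_re]
  linarith

/-- The constants lie in the closure of `φ · Poly` for an outer `φ`. -/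
theorem IsOuter.exists_trigPoly_mul_sub_one {φ : Circ → ℂ} (hφ : MemH2 φ) (ho : IsOuter φ)
    {δ : ℝ} (hδ : 0 < δ) :
    ∃ (n : ℕ) (a : ℕ → ℂ),
      ∫ t, ‖(∑ k ∈ Finset.range (n + 1), a k * e k t) * φ t - 1‖ ^ 2 ∂leb < δ := by
  obtain ⟨c, hc, G, hG, ρ, h0, h1, hexpand⟩ :=
    ho.exists_dilate_mul_sub_const hφ (show 0 < δ / 4 by linarith)
  have hφ2 := integrable_norm_sq hφ.1
  have hgφ := memLp_continuous_mul (continuous_dilate hG.continuousOn h0 h1) hφ.1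
  obtain ⟨η, hη, hη2⟩ : ∃ η > 0, η ^ 2 * ∫ t, ‖φ t‖ ^ 2 ∂leb < δ / 4 := by
    have h8 := ((tendsto_id (x := 𝓝 (0 : ℝ))).pow 2).mul_const (∫ t, ‖φ t‖ ^ 2 ∂leb)
    rw [zero_pow two_ne_zero, zero_mul] at h8
    obtain ⟨η, h9, h10⟩ := (((h8.mono_left nhdsWithin_le_nhds).eventually
      (gt_mem_nhds (show 0 < δ / 4 by linarith))).and
      (eventually_mem_nhdsWithin (s := Set.Ioi (0 : ℝ)))).exists
    exact ⟨η, h10, h9⟩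
  obtain ⟨n, a, -, ha⟩ := exists_trigPoly_approx hG h0 h1 hη
  refine ⟨n, fun j => conj c * a j, ?_⟩
  have hb : ∀ t, ‖(∑ j ∈ Finset.range (n + 1), conj c * a j * e j t) * φ t - 1‖ ^ 2 ≤
      2 * ‖G (ρ * e 1 t) * φ t - c‖ ^ 2 + 2 * (η ^ 2 * ‖φ t‖ ^ 2) := by
    intro t
    have ht := ha t
    simp only [mul_assoc, ← Finset.mul_sum]
    generalize ∑ j ∈ Finset.range (n + 1), a j * e j t = S at ht ⊢
    generalize G (ρ * e 1 t) = g at ht ⊢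
    have h3 : conj c * c = 1 := by
      rw [mul_comm, Complex.mul_conj, Complex.normSq_eq_norm_sq, hc]; simp
    have h11 : conj c * (S * φ t) - 1 = conj c * ((g * φ t - c) - (g - S) * φ t) := by
      linear_combination h3
    have h12 : ‖(g - S) * φ t‖ ≤ η * ‖φ t‖ := by
      rw [norm_mul]
      exact mul_le_mul_of_nonneg_right ht.le (norm_nonneg _)
    rw [h11, norm_mul, RCLike.norm_conj, hc, one_mul]
    have h13 : ‖g * φ t - c - (g - S) * φ t‖ ≤ ‖g * φ t - c‖ + η * ‖φ t‖ :=
      (norm_sub_le _ _).trans (by gcongr)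
    calc _ ≤ (‖g * φ t - c‖ + η * ‖φ t‖) ^ 2 := by gcongr
      _ ≤ _ := by nlinarith [sq_nonneg (‖g * φ t - c‖ - η * ‖φ t‖)]
  have j1 : Integrable (fun t => ‖G (ρ * e 1 t) * φ t - c‖ ^ 2) leb :=
    integrable_norm_sq (hgφ.sub (memLp_const c))
  have j2 := hφ2.const_mul (η ^ 2)
  have j3 : ∫ t, (2 * ‖G (ρ * e 1 t) * φ t - c‖ ^ 2 + 2 * (η ^ 2 * ‖φ t‖ ^ 2)) ∂leb < δ := by
    rw [integral_add (j1.const_mul 2) (j2.const_mul 2), integral_const_mul,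
      integral_const_mul, integral_const_mul]
    linarith
  refine lt_of_le_of_lt (integral_mono_of_nonneg (ae_of_all _ fun t => ?_)
    ((j1.const_mul 2).add (j2.const_mul 2)) (ae_of_all _ hb)) j3
  exact sq_nonneg _

/-- **Cyclicity of outer functions** in its dual form: an `L²` function that annihilates the
`e_j φ` with `j ≥ 1` annihilates the `e_m` with `m ≥ 1`. -/
theorem IsOuter.integral_e_mul_eq_zero {φ : Circ → ℂ} (hφ : MemH2 φ) (ho : IsOuter φ)
    {v : Circ → ℂ} (hv : MemLp v 2 leb)
    (h0 : ∀ j : ℕ, 1 ≤ j → ∫ t, e j t * φ t * v t ∂leb = 0) {m : ℕ} (hm : 1 ≤ m) :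
    ∫ t, e m t * v t ∂leb = 0 := by
  have hφv : Integrable (fun t => φ t * v t) leb := hφ.1.integrable_mul hv
  have hvi : Integrable v leb := hv.integrable one_le_two
  have hev : Integrable (fun t => e m t * v t) leb :=
    hvi.bdd_mul (continuous_e _).aestronglyMeasurable (ae_of_all _ fun t => (norm_e _ t).le)
  -- Replace `1` by `1 - S φ` with `‖1 - S φ‖² < 1 / K²`; the `S φ` part contributes nothing.
  have key : ∀ K : ℝ, 0 < K →
      ‖∫ t, e m t * v t ∂leb‖ ≤ (1 + ∫ t, ‖v t‖ ^ 2 ∂leb) * K⁻¹ := by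
    intro K hK
    obtain ⟨n, a, ha⟩ := ho.exists_trigPoly_mul_sub_one hφ
      (show 0 < 1 / K ^ 2 by positivity)
    set S : Circ → ℂ := fun t => ∑ k ∈ Finset.range (n + 1), a k * e k t with hS
    have hSc : Continuous S :=
      continuous_finsetSum _ fun k _ => continuous_const.mul (continuous_e k)
    have hterm : ∀ k : ℕ, Integrable (fun t => a k * (e (m + k : ℕ) t * φ t * v t)) leb :=
      fun k => by
        simp only [mul_assoc (e _ _)]
        exact (hφv.bdd_mul (continuous_e _).aestronglyMeasurable
          (ae_of_all _ fun t => (norm_e _ t).le)).const_mul _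
    have hexp : ∀ t, e m t * (S t * φ t) * v t =
        ∑ k ∈ Finset.range (n + 1), a k * (e (m + k : ℕ) t * φ t * v t) := by
      intro t
      rw [hS, Finset.sum_mul, Finset.mul_sum, Finset.sum_mul]
      refine Finset.sum_congr rfl fun k _ => ?_
      rw [Nat.cast_add, e_add]
      ring
    have h1 : ∫ t, e m t * (S t * φ t) * v t ∂leb = 0 := by
      simp only [hexp]
      rw [integral_finsetSum _ fun k _ => hterm k]
      refine Finset.sum_eq_zero fun k _ => ?_
      rw [integral_const_mul, h0 _ (by omega), mul_zero]
    have hi1 : Integrable (fun t => e m t * (S t * φ t) * v t) leb := by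
      simp only [hexp]
      exact integrable_finsetSum _ fun k _ => hterm k
    have h2 : ∫ t, e m t * v t ∂leb =
        ∫ t, (e m t * v t - e m t * (S t * φ t) * v t) ∂leb := by
      rw [integral_sub hev hi1, h1, sub_zero]
    have hSφ : MemLp (fun t => S t * φ t - 1) 2 leb :=
      (memLp_continuous_mul hSc hφ.1).sub (memLp_const 1)
    have hi2 := integrable_norm_sq hSφ
    have hi3 := integrable_norm_sq hv
    rw [h2]
    calc _ ≤ ∫ t, (K * ‖S t * φ t - 1‖ ^ 2 + K⁻¹ * ‖v t‖ ^ 2) ∂leb := by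
          refine norm_integral_le_of_norm_le ((hi2.const_mul _).add (hi3.const_mul _))
            (ae_of_all _ fun t => ?_)
          have h3 : e m t * v t - e m t * (S t * φ t) * v t =
              -(e m t * ((S t * φ t - 1) * v t)) := by ring
          rw [h3, norm_neg, norm_mul, norm_e, one_mul, norm_mul]
          have h4 := mul_nonneg (inv_nonneg.2 hK.le)
            (sq_nonneg (K * ‖S t * φ t - 1‖ - ‖v t‖))
          have h5 : K⁻¹ * (K * ‖S t * φ t - 1‖ - ‖v t‖) ^ 2 =
              K * ‖S t * φ t - 1‖ ^ 2 - 2 * (‖S t * φ t - 1‖ * ‖v t‖) + K⁻¹ * ‖v t‖ ^ 2 := by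
            field_simp
            ring
          have h6 : 0 ≤ ‖S t * φ t - 1‖ * ‖v t‖ := by positivity
          linarith
      _ = K * ∫ t, ‖S t * φ t - 1‖ ^ 2 ∂leb + K⁻¹ * ∫ t, ‖v t‖ ^ 2 ∂leb := by
          rw [integral_add (hi2.const_mul _) (hi3.const_mul _), integral_const_mul,
            integral_const_mul]
      _ ≤ K * (1 / K ^ 2) + K⁻¹ * ∫ t, ‖v t‖ ^ 2 ∂leb := by gcongr
      _ = (1 + ∫ t, ‖v t‖ ^ 2 ∂leb) * K⁻¹ := by field_simp
  rw [← norm_le_zero_iff]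
  have h7 := tendsto_inv_atTop_zero.const_mul (1 + ∫ t, ‖v t‖ ^ 2 ∂leb)
  rw [mul_zero] at h7
  exact ge_of_tendsto h7 ((eventually_gt_atTop 0).mono key)

/-! ### The finite sections in `L²` -/

theorem memLp_conj {φ : Circ → ℂ} (hφ : MemLp φ 2 leb) : MemLp (fun t => conj (φ t)) 2 leb :=
  hφ.star

/-- The vectors `e_{-1} conj(φ), e_{-2} conj(φ), …` of `L²(λ)`. -/
noncomputable def sectionVec {φ : Circ → ℂ} (hφ : MemLp φ 2 leb) (i : ℕ) : Lp ℂ 2 leb :=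
  (memLp_continuous_mul (continuous_e (-((i : ℤ) + 1))) (memLp_conj hφ)).toLp

theorem coeFn_sectionVec {φ : Circ → ℂ} (hφ : MemLp φ 2 leb) (i : ℕ) :
    sectionVec hφ i =ᵐ[leb] fun t => e (-((i : ℤ) + 1)) t * conj (φ t) :=
  MemLp.coeFn_toLp _

theorem coeFn_sum_sectionVec {φ : Circ → ℂ} (hφ : MemLp φ 2 leb) {ι : Type*} (s : Finset ι)
    (k : ι → ℕ) (c : ι → ℂ) :
    (∑ i ∈ s, c i • sectionVec hφ (k i) : Lp ℂ 2 leb) =ᵐ[leb]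
      fun t => (∑ i ∈ s, c i * e (-((k i : ℤ) + 1)) t) * conj (φ t) := by
  have h1 : ∀ i ∈ s, ∀ᵐ t ∂leb, (c i • sectionVec hφ (k i) : Lp ℂ 2 leb) t =
      c i * (e (-((k i : ℤ) + 1)) t * conj (φ t)) := fun i _ => by
    filter_upwards [Lp.coeFn_smul (c i) (sectionVec hφ (k i)), coeFn_sectionVec hφ (k i)]
      with t h2 h3
    rw [h2, Pi.smul_apply, h3, smul_eq_mul]
  filter_upwards [Lp.coeFn_finsetSum s fun i => c i • sectionVec hφ (k i),
    (Finset.eventually_all s).2 h1] with t h2 h3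
  rw [h2, Finset.sum_apply, Finset.sum_congr rfl h3, Finset.sum_mul]
  simp only [mul_assoc]

theorem inner_eq_integral (u v : Lp ℂ 2 leb) : inner ℂ u v = ∫ t, v t * conj (u t) ∂leb := by
  rw [L2.inner_def]
  rfl

theorem inner_eq_integral_of_ae {u v : Lp ℂ 2 leb} {u' v' : Circ → ℂ} (hu : u =ᵐ[leb] u')
    (hv : v =ᵐ[leb] v') : inner ℂ u v = ∫ t, v' t * conj (u' t) ∂leb := by
  rw [inner_eq_integral]
  refine integral_congr_ae ?_
  filter_upwards [hu, hv] with t h1 h2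
  rw [h1, h2]

theorem linearIndependent_sectionVec {φ : Circ → ℂ} (hφ : MemLp φ 2 leb)
    (h0 : ∀ᵐ t ∂leb, φ t ≠ 0) : LinearIndependent ℂ (sectionVec hφ) := by
  have hfour : LinearIndependent ℂ fun i : ℕ => fourierLp (T := 1) 2 (-((i : ℤ) + 1)) :=
    orthonormal_fourier.linearIndependent.comp _ fun i j h => by
      simpa using h
  rw [linearIndependent_iff'] at hfour ⊢
  intro s c hc
  refine hfour s c ?_
  rw [Lp.eq_zero_iff_ae_eq_zero]
  have h1 := coeFn_sum_sectionVec hφ s id c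
  simp only [id] at h1
  rw [hc] at h1
  have h2 : ∀ i ∈ s, ∀ᵐ t ∂leb, (c i • fourierLp (T := 1) 2 (-((i : ℤ) + 1)) : Lp ℂ 2 leb) t =
      c i * e (-((i : ℤ) + 1)) t := fun i _ => by
    filter_upwards [Lp.coeFn_smul (c i) (fourierLp (T := 1) 2 (-((i : ℤ) + 1))),
      coeFn_fourierLp (T := 1) 2 (-((i : ℤ) + 1))] with t h2 h3
    rw [h2, Pi.smul_apply, h3, smul_eq_mul]
    rfl
  filter_upwards [h1, h0, Lp.coeFn_zero ℂ 2 leb, (Finset.eventually_all s).2 h2,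
    Lp.coeFn_finsetSum s fun i : ℕ => c i • fourierLp (T := 1) 2 (-((i : ℤ) + 1))]
    with t h3 h4 h5 h6 h7
  rw [h5, Pi.zero_apply] at h3
  rw [h7, Finset.sum_apply, Finset.sum_congr rfl h6, Pi.zero_apply]
  exact (mul_eq_zero.1 h3.symm).resolve_right (by simpa using h4)

theorem inner_sectionVec {φ : Circ → ℂ} (hφ : MemLp φ 2 leb) (i : ℕ) (v : Lp ℂ 2 leb) :
    inner ℂ (sectionVec hφ i) v = ∫ t, e (i + 1 : ℕ) t * φ t * v t ∂leb := by
  rw [inner_eq_integral_of_ae (coeFn_sectionVec hφ i) (ae_eq_refl v)]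
  refine integral_congr_ae (ae_of_all _ fun t => ?_)
  simp only [map_mul, Complex.conj_conj, e_neg]
  push_cast
  ring

/-- The sections are orthogonal to `H²`. -/
theorem sectionVec_mem_orthogonal {φ : Circ → ℂ} (hφ : MemH2 φ) (i : ℕ) :
    sectionVec hφ.1 i ∈ hardyᗮ := by
  rw [Submodule.mem_orthogonal']
  intro v hv
  rw [← fourierBasis.tsum_inner_mul_inner (sectionVec hφ.1 i) v]
  refine (tsum_congr fun n => ?_).trans tsum_zero
  rcases lt_or_ge n 0 with hn | hn
  · have h1 := hv n hn
    rw [← fourierBasis_repr, HilbertBasis.repr_apply_apply] at h1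
    rw [h1, mul_zero]
  · rw [inner_sectionVec]
    have h2 : ∫ t, e (i + 1 : ℕ) t * φ t * fourierBasis (T := 1) n t ∂leb =
        fourierCoeff φ (-(n + (i + 1 : ℕ))) := by
      rw [fourierCoeff, neg_neg]
      refine integral_congr_ae ?_
      rw [coe_fourierBasis]
      filter_upwards [coeFn_fourierLp (T := 1) 2 n] with t ht
      rw [ht, smul_eq_mul, fourier_add]
      simp only [e]
      ring
    rw [h2, hφ.2 _ (by push_cast; omega), zero_mul]

/-- For an outer `φ` the sections exhaust the orthogonal complement of `H²`. -/
theorem orthogonal_hardy_le_closure {φ : Circ → ℂ} (hφ : MemH2 φ) (ho : IsOuter φ) :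
    hardyᗮ ≤ (Submodule.span ℂ (Set.range (sectionVec hφ.1))).topologicalClosure := by
  rw [← Submodule.orthogonal_orthogonal_eq_closure]
  refine Submodule.orthogonal_le fun v hv n hn => ?_
  obtain ⟨m, rfl⟩ : ∃ m : ℕ, n = -m := ⟨n.natAbs, by omega⟩
  rw [fourierCoeff, neg_neg]
  refine ho.integral_e_mul_eq_zero hφ (Lp.memLp v) (fun j hj => ?_) (by omega)
  obtain ⟨i, rfl⟩ : ∃ i, j = i + 1 := ⟨j - 1, by omega⟩
  rw [← inner_sectionVec hφ.1 i v]
  exact (Submodule.mem_orthogonal _ _).1 hv _ (Submodule.subset_span ⟨i, rfl⟩)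

/-- The substitution `S ↦ e_{-1} conj(S)` carries `φ · Poly_n` to the span of the first `n + 1`
section vectors. -/
theorem coeFn_sum_sectionVec_conj {φ : Circ → ℂ} (hφ : MemLp φ 2 leb) {n : ℕ}
    (c : Fin (n + 1) → ℂ) :
    (∑ i, conj (c i) • sectionVec hφ i : Lp ℂ 2 leb) =ᵐ[leb]
      fun t => e (-1) t * conj ((φ * ∑ i : Fin (n + 1), c i • e (i : ℤ)) t) := by
  filter_upwards [coeFn_sum_sectionVec hφ Finset.univ (fun i : Fin (n + 1) => (i : ℕ))
    fun i => conj (c i)] with t ht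
  rw [ht, Pi.mul_apply, Finset.sum_apply, map_mul, map_sum, mul_left_comm, Finset.mul_sum,
    mul_comm (conj (φ t))]
  congr 1
  refine Finset.sum_congr rfl fun i _ => ?_
  rw [Pi.smul_apply, smul_eq_mul, map_mul, ← e_neg, neg_add, e_add]
  ring

theorem norm_sum_sectionVec_conj {φ : Circ → ℂ} (hφ : MemLp φ 2 leb) {n : ℕ}
    (c : Fin (n + 1) → ℂ) :
    ‖∑ i, conj (c i) • sectionVec hφ i‖ =
      l2norm (φ * ∑ i : Fin (n + 1), c i • e (i : ℤ)) := by
  rw [Lp.norm_def, l2norm]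
  congr 1
  refine eLpNorm_congr_norm_ae ?_
  filter_upwards [coeFn_sum_sectionVec_conj hφ c] with t ht
  rw [ht, norm_mul, norm_e, one_mul, RCLike.norm_conj]

theorem inner_sum_sectionVec_conj {φ ψ : Circ → ℂ} (hφ : MemLp φ 2 leb) (hψ : MemLp ψ 2 leb)
    {n : ℕ} (c d : Fin (n + 1) → ℂ) :
    inner ℂ (∑ i, conj (d i) • sectionVec hψ i) (∑ i, conj (c i) • sectionVec hφ i) =
      conj (ip (φ * ∑ i : Fin (n + 1), c i • e (i : ℤ))
        (ψ * ∑ i : Fin (n + 1), d i • e (i : ℤ))) := by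
  rw [inner_eq_integral_of_ae (coeFn_sum_sectionVec_conj hψ d) (coeFn_sum_sectionVec_conj hφ c),
    ip, ← integral_conj]
  refine integral_congr_ae (ae_of_all _ fun t => ?_)
  have h1 : e (-1) t * conj (e (-1) t) = 1 := by
    rw [Complex.mul_conj, Complex.normSq_eq_norm_sq, norm_e]; simp
  simp only [map_mul, Complex.conj_conj]
  linear_combination (conj ((φ * ∑ i : Fin (n + 1), c i • e (i : ℤ)) t) *
    (ψ * ∑ i : Fin (n + 1), d i • e (i : ℤ)) t) * h1

/-- The index shifts by one: `Poly n` corresponds to the sections of length `n + 1`. -/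
theorem AngleCondition.sectionAngle {φ ψ : Circ → ℂ} (h : AngleCondition φ ψ)
    (hφ : MemLp φ 2 leb) (hψ : MemLp ψ 2 leb) :
    ∃ ε : ℝ, 0 < ε ∧ ∀ᶠ n in atTop, SectionAngle (sectionVec hφ) (sectionVec hψ) ε n := by
  obtain ⟨ε, hε, n₀, hn⟩ := h
  refine ⟨ε, hε, eventually_atTop.2 ⟨n₀ + 1, fun n hn' => ?_⟩⟩
  obtain ⟨n, rfl⟩ : ∃ m, n = m + 1 := ⟨n - 1, by omega⟩
  intro s
  obtain ⟨T, hT, hT0, hle⟩ := hn n (by omega) (∑ i : Fin (n + 1), conj (s i) • e (i : ℤ))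
    ((Submodule.mem_span_range_iff_exists_fun ℂ).2 ⟨_, rfl⟩)
  obtain ⟨d, rfl⟩ := (Submodule.mem_span_range_iff_exists_fun ℂ).1 hT
  refine ⟨fun i => conj (d i), fun h0 => hT0 ?_, ?_⟩
  · refine Finset.sum_eq_zero fun i _ => ?_
    have h1 : conj (d i) = 0 := congrFun h0 i
    rw [(map_eq_zero _).1 h1, zero_smul]
  · have h2 := norm_sum_sectionVec_conj hφ fun i => conj (s i)
    have h3 := inner_sum_sectionVec_conj hφ hψ (fun i => conj (s i)) d
    simp only [Complex.conj_conj] at h2 h3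
    rw [h2, h3, norm_sum_sectionVec_conj hψ d, RCLike.norm_conj]
    have h4 := (Complex.le_def.1 hle).1
    rw [Complex.ofReal_re] at h4
    exact h4.trans (Complex.re_le_norm _)

/-! ### The determinants as cross Gram determinants -/

theorem inner_toLp_mul_conj {φ ψ p q : Circ → ℂ}
    (hp : MemLp (fun t => p t * conj (φ t)) 2 leb) (hq : MemLp (fun t => q t * conj (ψ t)) 2 leb) :
    inner ℂ hq.toLp hp.toLp = densityIntegral (density φ ψ) fun t => p t * conj (q t) := by
  rw [inner_eq_integral_of_ae hq.coeFn_toLp hp.coeFn_toLp, densityIntegral]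
  refine integral_congr_ae (ae_of_all _ fun t => ?_)
  simp only [density, map_mul, Complex.conj_conj]
  ring

theorem integrable_mul_conj_density {φ ψ p q : Circ → ℂ}
    (hp : MemLp (fun t => p t * conj (φ t)) 2 leb) (hq : MemLp (fun t => q t * conj (ψ t)) 2 leb) :
    Integrable (fun t => p t * conj (q t) * density φ ψ t) leb := by
  refine (hp.integrable_mul (memLp_conj hq)).congr (ae_of_all _ fun t => ?_)
  simp only [Pi.mul_apply, density, map_mul, Complex.conj_conj]
  ring

/-- The Toeplitz matrix is the transpose of the cross Gram matrix of the section vectors. -/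
theorem toeplitzDet_density_eq {φ ψ : Circ → ℂ} (hφ : MemLp φ 2 leb) (hψ : MemLp ψ 2 leb)
    (n : ℕ) :
    toeplitzDet (density φ ψ) n = (crossGram (fun i : Fin (n + 1) => sectionVec hφ i)
      fun i : Fin (n + 1) => sectionVec hψ i).det := by
  rw [toeplitzDet, ← Matrix.det_transpose]
  congr 1
  ext j k
  rw [crossGram, Matrix.transpose_apply, Matrix.of_apply, Matrix.of_apply, sectionVec, sectionVec,
    inner_toLp_mul_conj, measCoeff]
  congr 1
  ext t
  rw [← e_neg, ← e_add]
  congr 1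
  ring

theorem memLp_bordered_mul_conj {φ : Circ → ℂ} (hφ : MemLp φ 2 leb) {r : ℕ}
    {f : Fin (r + 1) → Circ → ℂ} (hf : ∀ j, MemLp (fun t => f j t * conj (φ t)) 2 leb) (n : ℕ)
    (j : Fin (r + 1) ⊕ Fin n) : MemLp (fun t => bordered f n j t * conj (φ t)) 2 leb := by
  rcases j with j | j
  · exact hf j
  · exact memLp_continuous_mul (continuous_e _) (memLp_conj hφ)

theorem borderedDet_density_eq {φ ψ : Circ → ℂ} (hφ : MemLp φ 2 leb) (hψ : MemLp ψ 2 leb)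
    {r : ℕ} {f g : Fin (r + 1) → Circ → ℂ} (hf : ∀ j, MemLp (fun t => f j t * conj (φ t)) 2 leb)
    (hg : ∀ j, MemLp (fun t => g j t * conj (ψ t)) 2 leb) (n : ℕ) :
    borderedDet (density φ ψ) f g n =
      (crossGram (Sum.elim (fun j => (hf j).toLp) fun i : Fin n => sectionVec hφ i)
        (Sum.elim (fun j => (hg j).toLp) fun i : Fin n => sectionVec hψ i)).det := by
  have h1 : ∀ j, Sum.elim (fun j => (hf j).toLp) (fun i : Fin n => sectionVec hφ i) j =
      (memLp_bordered_mul_conj hφ hf n j).toLp := by rintro (j | j) <;> rfl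
  have h2 : ∀ j, Sum.elim (fun j => (hg j).toLp) (fun i : Fin n => sectionVec hψ i) j =
      (memLp_bordered_mul_conj hψ hg n j).toLp := by rintro (j | j) <;> rfl
  rw [borderedDet]
  congr 1
  ext j k
  rw [crossGram, Matrix.of_apply, Matrix.of_apply, h1, h2, inner_toLp_mul_conj]

end SzegoLimit

theorem theorem4p2 (φ ψ : SzegoLimit.Circ → ℂ)
    (hφ : SzegoLimit.MemH2 φ) (hψ : SzegoLimit.MemH2 ψ)
    (hφo : SzegoLimit.IsOuter φ) (hψo : SzegoLimit.IsOuter ψ)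
    (hangle : SzegoLimit.AngleCondition φ ψ)
    (r : ℕ) (f g : Fin (r + 1) → SzegoLimit.Circ → ℂ)
    (hf : ∀ j, MemLp (f j) 2 (SzegoLimit.sumWeight φ ψ))
    (hg : ∀ j, MemLp (g j) 2 (SzegoLimit.sumWeight φ ψ))
    (F G : Fin (r + 1) → Lp ℂ 2 SzegoLimit.leb)
    (hF : ∀ j, F j = SzegoLimit.hardyProj (fun t => f j t * conj (φ t))
      (SzegoLimit.memLp_mul_conj_left hφ.1 hψ.1 (hf j)))
    (hG : ∀ j, G j = SzegoLimit.hardyProj (fun t => g j t * conj (ψ t))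
      (SzegoLimit.memLp_mul_conj_right hφ.1 hψ.1 (hg j))) :
    (∀ n j k, Integrable (fun t => SzegoLimit.bordered f n j t *
        conj (SzegoLimit.bordered g n k t) * SzegoLimit.density φ ψ t) SzegoLimit.leb) ∧
      (∀ᶠ n : ℕ in atTop, SzegoLimit.toeplitzDet (SzegoLimit.density φ ψ) n ≠ 0) ∧
      Tendsto (fun n : ℕ => (SzegoLimit.toeplitzDet (SzegoLimit.density φ ψ) n)⁻¹ *
          SzegoLimit.borderedDet (SzegoLimit.density φ ψ) f g (n + 1)) atTop
        (𝓝 (Matrix.of fun j k : Fin (r + 1) =>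
          ∫ t, F j t * conj (G k t) ∂SzegoLimit.leb).det) := by
  have hfφ := fun j => SzegoLimit.memLp_mul_conj_left hφ.1 hψ.1 (hf j)
  have hgψ := fun j => SzegoLimit.memLp_mul_conj_right hφ.1 hψ.1 (hg j)
  have hx := SzegoLimit.linearIndependent_sectionVec hφ.1 hφo.ae_ne_zero
  have hy := SzegoLimit.linearIndependent_sectionVec hψ.1 hψo.ae_ne_zero
  obtain ⟨ε, hε, hsec⟩ := hangle.sectionAngle hφ.1 hψ.1
  refine ⟨fun n j k => SzegoLimit.integrable_mul_conj_density
    (SzegoLimit.memLp_bordered_mul_conj hφ.1 hfφ n j)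
    (SzegoLimit.memLp_bordered_mul_conj hψ.1 hgψ n k), ?_, ?_⟩
  · filter_upwards [(tendsto_add_atTop_nat 1).eventually hsec] with n hn
    rw [SzegoLimit.toeplitzDet_density_eq hφ.1 hψ.1]
    exact hn.det_ne_zero hx hy hε
  · have hlim := (SzegoLimit.tendsto_det_crossGram_ratio hε hsec hx hy SzegoLimit.hardy
      (SzegoLimit.sectionVec_mem_orthogonal hψ) (SzegoLimit.orthogonal_hardy_le_closure hφ hφo)
      (fun j => (hfφ j).toLp) fun j => (hgψ j).toLp).comp (tendsto_add_atTop_nat 1)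
    have hFG : SzegoLimit.crossGram (fun j => SzegoLimit.hardy.starProjection (hfφ j).toLp)
        (fun j => SzegoLimit.hardy.starProjection (hgψ j).toLp) =
        Matrix.of fun j k : Fin (r + 1) => ∫ t, F j t * conj (G k t) ∂SzegoLimit.leb := by
      ext j k
      rw [Matrix.of_apply, hF, hG]
      exact SzegoLimit.inner_eq_integral _ _
    rw [hFG] at hlim
    refine hlim.congr fun n => ?_
    rw [SzegoLimit.toeplitzDet_density_eq hφ.1 hψ.1,
      SzegoLimit.borderedDet_density_eq hφ.1 hψ.1 hfφ hgψ]
    rfl
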